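/- Let $d\ge 1$, $q\ge 1$ and $s\ge 0$ be integers, let $p$ be real, and assume $p>2$, $q<p<2q$ and $s>\frac{d(2q-p)}{2pq}$. Let $\Omega=[0,1]^d$ and let $W^{s,p}(\Omega)$ be the Sobolev space of $f\in L^p(\Omega)$ whose weak derivatives of order at most $s$ lie in $L^p(\Omega)$, with norm $\|f\|_{W^{s,p}}=\max_{|\alpha|\le s}\|D^\alpha f\|_{L^p(\Omega)}$. Let $x_1,x_2,\dots$ be independent and uniformly distributed on $\Omega$. For every $n\ge 1$ let $K_n:\Omega^n\times\mathbb R^n\to W^{s,p}(\Omega)$ be a (measurable) function estimator. Say that $(K_n)$ has the *oracle rates* on a set $F\subset W^{s,p}(\Omega)$ if for every real $r\ge 1$ with $\frac1r>\frac{d-sp}{pd}$ there is a constant $C_r$ such that for all $f\in F$ and $n\ge 1$ $$\Big(\mathbb E\,\big\|K_n(\{x_i\}_{i=1}^n,\{f(x_i)\}_{i=1}^n)-f\big\|_{L^r(\Omega)}^r\Big)^{1/r}\le C_r\,n^{-\frac sd+\max\{\frac1p-\frac1r,\,0\}}.$$ For even $n\ge 2$ and data $y_i=f(x_i)$, put $\hat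 f=K_{n/2}(\{x_i\}_{i=1}^{n/2},\{y_i\}_{i=1}^{n/2})$ and define the regression-adjusted control variate estimator $$\hat H^q_C=\int_\Omega \hat f(x)^q\,dx+\frac2n\sum_{i=n/2+1}^n\big(y_i^q-\hat f(x_i)^q\big),\qquad I_f^q=\int_\Omega f(x)^q\,dx.$$ (1) For every $f\in W^{s,p}(\Omega)$ such that $(K_n)$ has the oracle rates on $\{f\}$ (constants may depend on $f$, but not on $n$), there is a constant $C$ such that for all even $n\ge 2$ the expectation below is finite and $$\mathbb E\,\big|\hat H^q_C-I_f^q\big|\le C\,n^{\max\{-q(\frac sd-\frac1p)-1,\;-\frac sd-\frac12\}}.$$ (2) If $(K_n)$ has the oracle rates on a ball $\{f:\|f\|_{W^{s,p}}\le R\}$ (constants uniform over the ball), then the bound in (1) holds with one constant $C$ for all $f$ in that ball and all even $n\ge 2$. -/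

import Mathlib

open MeasureTheory
open scoped ENNReal ContDiff

noncomputable section

namespace ControlVariate

/-- The unit cube `Ω = [0,1]^d`. -/
def cube (d : ℕ) : Set (Fin d → ℝ) := Set.Icc 0 1

/-- The open unit cube `(0,1)^d`, the interior of `Ω`. -/
def openCube (d : ℕ) : Set (Fin d → ℝ) := Set.univ.pi fun _ => Set.Ioo 0 1

/-- The uniform distribution on `Ω`, that is, Lebesgue measure on `Ω` (which has total mass one). -/
def unif (d : ℕ) : Measure (Fin d → ℝ) := volume.restrict (cube d)

/-- The joint law of `n` independent uniformly distributed points of `Ω`. -/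
def sampleLaw (d n : ℕ) : Measure (Fin n → Fin d → ℝ) := Measure.pi fun _ => unif d

/-- The classical partial derivative `∂_{i 0} ⋯ ∂_{i (k-1)} φ` of order `k`. As `i` runs through all
finite sequences of coordinates, these are (for smooth `φ`) all derivatives `D^α φ`, where the
multi-index `α` counts how often each coordinate occurs in `i`, so that `|α| = k`. -/
def partialDeriv {d k : ℕ} (i : Fin k → Fin d) (φ : (Fin d → ℝ) → ℝ) (x : Fin d → ℝ) : ℝ :=
  iteratedFDeriv ℝ k φ x fun j => Pi.single (i j) 1

/-- Test functions on the open cube: smooth, with compact support inside it. -/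
def IsTestFunction {d : ℕ} (φ : (Fin d → ℝ) → ℝ) : Prop :=
  ContDiff ℝ ∞ φ ∧ HasCompactSupport φ ∧ tsupport φ ⊆ openCube d

/-- `g` is the weak derivative of `f` on the cube for the differentiation
`∂_{i 0} ⋯ ∂_{i (k-1)}`. Used for `f` and `g` in `L^p(Ω)`, `p ≥ 1`, only. -/
def IsWeakDeriv {d k : ℕ} (i : Fin k → Fin d) (f g : (Fin d → ℝ) → ℝ) : Prop :=
  ∀ φ : (Fin d → ℝ) → ℝ, IsTestFunction φ →
    ∫ x in cube d, f x * partialDeriv i φ x = (-1) ^ k * ∫ x in cube d, g x * φ x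

/-- The Sobolev space `W^{s,p}(Ω)` (as a set of representatives): `f ∈ L^p(Ω)`, and all weak
derivatives of order at most `s` exist and lie in `L^p(Ω)`. -/
def sobolev (d s : ℕ) (p : ℝ) : Set ((Fin d → ℝ) → ℝ) :=
  {f | MemLp f (ENNReal.ofReal p) (unif d) ∧
    ∀ k ≤ s, ∀ i : Fin k → Fin d, ∃ g : (Fin d → ℝ) → ℝ,
      MemLp g (ENNReal.ofReal p) (unif d) ∧ IsWeakDeriv i f g}

/-- The ball of radius `R` of `W^{s,p}(Ω)` for the norm `max_{|α| ≤ s} ‖D^α f‖_{L^p(Ω)}`. -/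
def sobolevBall (d s : ℕ) (p R : ℝ) : Set ((Fin d → ℝ) → ℝ) :=
  {f | MemLp f (ENNReal.ofReal p) (unif d) ∧
    ∀ k ≤ s, ∀ i : Fin k → Fin d, ∃ g : (Fin d → ℝ) → ℝ,
      MemLp g (ENNReal.ofReal p) (unif d) ∧ IsWeakDeriv i f g ∧
        eLpNorm g (ENNReal.ofReal p) (unif d) ≤ ENNReal.ofReal R}

/-- A sequence of function estimators: `K n x y` is the function estimated from the `n` points `x`
and the `n` observed values `y`. -/
abbrev Oracle (d : ℕ) : Type :=
  (n : ℕ) → (Fin n → Fin d → ℝ) → (Fin n → ℝ) → (Fin d → ℝ) → ℝ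

/-- `K n` is a map `Ω^n × ℝ^n → W^{s,p}(Ω)`, and for data from `f ∈ W^{s,p}(Ω)` the value of the
estimated function at a point is measurable, up to null sets, in the sample and the point. -/
structure IsFunctionEstimator (d s : ℕ) (p : ℝ) (K : Oracle d) : Prop where
  mem_sobolev : ∀ n, 0 < n → ∀ x : Fin n → Fin d → ℝ, (∀ i, x i ∈ cube d) →
    ∀ y : Fin n → ℝ, K n x y ∈ sobolev d s p
  aemeasurable : ∀ n, 0 < n → ∀ f ∈ sobolev d s p,
    AEMeasurable (fun z : (Fin n → Fin d → ℝ) × (Fin d → ℝ) => K n z.1 (f ∘ z.1) z.2)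
      ((sampleLaw d n).prod (unif d))

/-- The rates required of the oracle, with constants `C` that are uniform over the class `F`:
for every finite `r` with `1/r ∈ ((d-sp)/(pd), 1]`,
`(E ‖K_n(x, f(x)) - f‖_{L^r}^r)^{1/r} ≤ C n^{-s/d + (1/p - 1/r)_+}`. -/
def HasOracleRate (d s : ℕ) (p : ℝ) (K : Oracle d) (F : Set ((Fin d → ℝ) → ℝ)) : Prop :=
  ∀ r : ℝ, 1 ≤ r → (d - s * p) / (p * d) < 1 / r →
    ∃ C : ℝ, ∀ f ∈ F, ∀ n : ℕ, 0 < n →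
      (∫⁻ x, eLpNorm (fun z => K n x (f ∘ x) z - f z) (ENNReal.ofReal r) (unif d) ^ r
          ∂(sampleLaw d n)) ^ (1 / r)
        ≤ ENNReal.ofReal (C * (n : ℝ) ^ (-(s : ℝ) / d + max (1 / p - 1 / r) 0))

/-- The `q`-th moment `I_f^q = ∫_Ω f^q`. -/
def moment {d : ℕ} (q : ℕ) (f : (Fin d → ℝ) → ℝ) : ℝ := ∫ z in cube d, f z ^ q

/-- The regression-adjusted control variate estimator from an even number `n = m + m` of data
points: the first half gives the control variate `g = K m`, the second half gives a Monte Carlo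
estimate of `∫_Ω (f^q - g^q)`. -/
def estimator {d : ℕ} (K : Oracle d) (q m : ℕ) (x : Fin (m + m) → Fin d → ℝ)
    (y : Fin (m + m) → ℝ) : ℝ :=
  let g : (Fin d → ℝ) → ℝ :=
    K m (fun i => x (Fin.castAdd m i)) (fun i => y (Fin.castAdd m i))
  (∫ z in cube d, g z ^ q) +
    2 / ((m + m : ℕ) : ℝ) *
      ∑ i : Fin m, (y (Fin.natAdd m i) ^ q - g (x (Fin.natAdd m i)) ^ q)

/-- `C` bounds the expected absolute error for `f` at the claimed rate, for every even sample size
`n = m + m ≥ 2`; in particular that expectation is finite. -/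
def ErrorBound (d s q : ℕ) (p : ℝ) (K : Oracle d) (f : (Fin d → ℝ) → ℝ) (C : ℝ) : Prop :=
  ∀ m : ℕ, 0 < m →
    Integrable (fun x => estimator K q m x (f ∘ x) - moment q f) (sampleLaw d (m + m)) ∧
    ∫ x, |estimator K q m x (f ∘ x) - moment q f| ∂(sampleLaw d (m + m))
      ≤ C * ((m + m : ℕ) : ℝ) ^
          max (-(q : ℝ) * ((s : ℝ) / d - 1 / p) - 1) (-(s : ℝ) / d - 1 / 2)

end ControlVariate

end

/-
Conditionally on the first half of the sample, the estimator is an unbiased Monte Carlo estimator of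
`I_f^q` with integrand `f ^ q - g ^ q`, where `g` is the control variate. Its mean absolute error is
therefore at most `m ^ (-1/2)` times the mean of `‖f ^ q - g ^ q‖_{L^2}`, and

  `‖f ^ q - g ^ q‖_{L^2} ≲ ‖g - f‖_{L^a} ‖f‖_{L^{b (q - 1)}} ^ (q - 1) + ‖g - f‖_{L^{2 q}} ^ q`

whenever `1 / a + 1 / b = 1 / 2`. The oracle rates in `L^a` and `L^{2 q}` bound the distances, and
the Sobolev embedding bounds the norm of `f` uniformly over balls.

The embedding is proved for smooth functions on boxes by the method of Gagliardo and Nirenberg, with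
a zeroth order term since there are no boundary conditions. It passes to weak derivatives by
mollifying on slightly smaller cubes and applying Fatou's lemma.
-/

namespace ControlVariate

open scoped NNReal Convolution Topology

section Box

variable {ι E : Type*} [Fintype ι] [NormedAddCommGroup E]

theorem volume_restrict_Icc_eq_pi (a b : ι → ℝ) :
    volume.restrict (Set.Icc a b) = Measure.pi fun i => volume.restrict (Set.Icc (a i) (b i)) := by
  rw [← Set.pi_univ_Icc, volume_pi, Measure.restrict_pi_pi]

theorem enorm_le_setLAverage_add_setLIntegral_enorm_deriv [NormedSpace ℝ E] [CompleteSpace E]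
    {v : ℝ → E} (hv : ContDiff ℝ 1 v) {a b x : ℝ} (hab : a < b) (hx : x ∈ Set.Icc a b) :
    ‖v x‖ₑ ≤ (⨍⁻ t in Set.Icc a b, ‖v t‖ₑ ∂volume) + ∫⁻ t in Set.Icc a b, ‖deriv v t‖ₑ := by
  obtain ⟨t, ht, hvt⟩ := exists_le_setLAverage (μ := volume) (s := Set.Icc a b)
    (by simpa using hab) (by simp) hv.continuous.enorm.aemeasurable
  have hdiff : ‖v x - v t‖ₑ ≤ ∫⁻ s in Set.Icc a b, ‖deriv v s‖ₑ := by
    rw [← intervalIntegral.integral_deriv_eq_sub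
      (fun s _ => hv.differentiable one_ne_zero s)
      ((hv.continuous_deriv le_rfl).intervalIntegrable _ _), ← enorm_norm,
      intervalIntegral.norm_integral_eq_norm_integral_uIoc, enorm_norm]
    exact (enorm_integral_le_lintegral_enorm _).trans
      (lintegral_mono_set (Set.uIoc_subset_uIcc.trans (Set.uIcc_subset_Icc ht hx)))
  calc ‖v x‖ₑ = ‖v t + (v x - v t)‖ₑ := by rw [add_sub_cancel]
    _ ≤ ‖v t‖ₑ + ‖v x - v t‖ₑ := enorm_add_le _ _
    _ ≤ _ := add_le_add hvt hdiff

theorem enorm_le_setLIntegral_line [DecidableEq ι] [NormedSpace ℝ E] [CompleteSpace E]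
    {u : (ι → ℝ) → E} (hu : ContDiff ℝ 1 u) {a b x : ι → ℝ} {ℓ : ℝ} (hℓ : 0 < ℓ)
    (hab : ∀ i, ℓ ≤ b i - a i) (hx : x ∈ Set.Icc a b) (i : ι) :
    ‖u x‖ₑ ≤ ∫⁻ t in Set.Icc (a i) (b i), (ENNReal.ofReal ℓ⁻¹ * ‖u (Function.update x i t)‖ₑ +
      ‖fderiv ℝ u (Function.update x i t)‖ₑ) := by
  have hline : ContDiff ℝ 1 (u ∘ Function.update x i) := hu.comp (contDiff_update 1 x i)
  have hderiv (t : ℝ) :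
      ‖deriv (u ∘ Function.update x i) t‖ₑ ≤ ‖fderiv ℝ u (Function.update x i t)‖ₑ := by
    rw [fderiv_comp_deriv _ (hu.differentiable one_ne_zero _)
      (hasDerivAt_update x i t).differentiableAt]
    refine (ContinuousLinearMap.le_opENorm _ _).trans ?_
    simp [deriv_update, Pi.enorm_single]
  have hside : (volume (Set.Icc (a i) (b i)))⁻¹ ≤ ENNReal.ofReal ℓ⁻¹ := by
    rw [ENNReal.ofReal_inv_of_pos hℓ, Real.volume_Icc]
    exact ENNReal.inv_le_inv.2 (ENNReal.ofReal_le_ofReal (hab i))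
  have h := enorm_le_setLAverage_add_setLIntegral_enorm_deriv hline
    (sub_pos.1 (hℓ.trans_le (hab i))) ⟨hx.1 i, hx.2 i⟩
  simp only [Function.comp_apply, Function.update_eq_self] at h
  have hmeas : Measurable fun t => ‖u (Function.update x i t)‖ₑ := hline.continuous.enorm.measurable
  rw [lintegral_add_left (hmeas.const_mul _), lintegral_const_mul _ hmeas]
  rw [setLAverage_eq, ENNReal.div_eq_inv_mul] at h
  exact h.trans (add_le_add (by gcongr) (lintegral_mono hderiv))

theorem setLIntegral_enorm_rpow_le_of_holderConjugate [NormedSpace ℝ E] [CompleteSpace E]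
    {u : (ι → ℝ) → E} (hu : ContDiff ℝ 1 u) {p : ℝ} (hp : Real.HolderConjugate (Fintype.card ι) p)
    {a b : ι → ℝ} {ℓ : ℝ} (hℓ : 0 < ℓ) (hab : ∀ i, ℓ ≤ b i - a i) :
    ∫⁻ x in Set.Icc a b, ‖u x‖ₑ ^ p ≤
      (∫⁻ x in Set.Icc a b, (ENNReal.ofReal ℓ⁻¹ * ‖u x‖ₑ + ‖fderiv ℝ u x‖ₑ)) ^ p := by
  classical
  have hc := hu.continuous
  have hfc : Continuous (fderiv ℝ u) := hu.continuous_fderiv one_ne_zero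
  have hcard : (0 : ℝ) < Fintype.card ι - 1 := hp.sub_one_pos
  have hgrid := lintegral_prod_lintegral_pow_le
    (fun i => (volume : Measure ℝ).restrict (Set.Icc (a i) (b i))) hp
    (f := fun x => ENNReal.ofReal ℓ⁻¹ * ‖u x‖ₑ + ‖fderiv ℝ u x‖ₑ)
    (((hc.enorm.measurable).const_mul _).add hfc.enorm.measurable)
  rw [← volume_restrict_Icc_eq_pi] at hgrid
  refine le_trans (setLIntegral_mono' measurableSet_Icc fun x hx => ?_) hgrid
  calc ‖u x‖ₑ ^ p = ∏ _i : ι, ‖u x‖ₑ ^ (1 / (Fintype.card ι - 1 : ℝ)) := by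
        rw [Finset.prod_const, Finset.card_univ, ← ENNReal.rpow_natCast, ← ENNReal.rpow_mul,
          hp.conjugate_eq, one_div_mul_eq_div]
    _ ≤ _ := Finset.prod_le_prod' fun i _ => ENNReal.rpow_le_rpow
        (enorm_le_setLIntegral_line hu hℓ hab hx i) (one_div_nonneg.2 hcard.le)

theorem setLIntegral_enorm_rpow_lt_top {f : (ι → ℝ) → E} (hf : Continuous f) (a b : ι → ℝ)
    {r : ℝ} (hr : 0 ≤ r) : ∫⁻ x in Set.Icc a b, ‖f x‖ₑ ^ r < ⊤ := by
  obtain ⟨C, hC⟩ := isCompact_Icc.exists_bound_of_continuousOn hf.continuousOn (s := Set.Icc a b)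
  refine setLIntegral_lt_top_of_le_nnreal isCompact_Icc.measure_lt_top.ne
    ⟨C.toNNReal ^ r, fun x hx => ?_⟩
  rw [ENNReal.coe_rpow_of_nonneg _ hr]
  gcongr
  rw [← ofReal_norm]
  exact ENNReal.ofReal_le_ofReal (hC x hx)

section Norm

variable {F : Type*} [NormedAddCommGroup F] [InnerProductSpace ℝ F]

theorem rpow_setLIntegral_enorm_rpow_le_of_one_lt {u : (ι → ℝ) → F} (hu : ContDiff ℝ 1 u) {p γ : ℝ}
    (hp : Real.HolderConjugate (Fintype.card ι) p) (hγ : 1 < γ) {a b : ι → ℝ} {ℓ : ℝ} (hℓ : 0 < ℓ)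
    (hab : ∀ i, ℓ ≤ b i - a i) :
    (∫⁻ x in Set.Icc a b, ‖u x‖ₑ ^ (γ * p)) ^ (1 / p) ≤
      ∫⁻ x in Set.Icc a b, ‖u x‖ₑ ^ (γ - 1) *
        (ENNReal.ofReal ℓ⁻¹ * ‖u x‖ₑ + ENNReal.ofReal γ * ‖fderiv ℝ u x‖ₑ) := by
  have hγ0 : 0 ≤ γ := by linarith
  have henorm (x : ι → ℝ) : ‖‖u x‖ ^ γ‖ₑ = ‖u x‖ₑ ^ γ := by
    rw [Real.enorm_rpow_of_nonneg (norm_nonneg _) hγ0, enorm_norm]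
  have hpow (x : ι → ℝ) : ‖u x‖ₑ ^ γ = ‖u x‖ₑ ^ (γ - 1) * ‖u x‖ₑ := by
    nth_rw 3 [← ENNReal.rpow_one ‖u x‖ₑ]
    rw [← ENNReal.rpow_add_of_nonneg _ _ (by linarith) zero_le_one, sub_add_cancel]
  have hfderiv (x : ι → ℝ) : ‖fderiv ℝ (fun x => ‖u x‖ ^ γ) x‖ₑ ≤
      ‖u x‖ₑ ^ (γ - 1) * (ENNReal.ofReal γ * ‖fderiv ℝ u x‖ₑ) := by
    have h := enorm_fderiv_norm_rpow_le (hu.differentiable one_ne_zero) (x := x)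
      (p := γ.toNNReal) (Real.one_lt_toNNReal.2 hγ)
    rw [Real.coe_toNNReal γ hγ0] at h
    exact h.trans_eq (by rw [mul_left_comm, ← mul_assoc]; rfl)
  have hmain := setLIntegral_enorm_rpow_le_of_holderConjugate (hu.norm_rpow hγ) hp hℓ hab
  simp only [henorm, ← ENNReal.rpow_mul] at hmain
  rw [one_div, ENNReal.rpow_inv_le_iff hp.symm.pos]
  refine hmain.trans (ENNReal.rpow_le_rpow (lintegral_mono fun x => ?_) hp.symm.nonneg)
  rw [mul_add]
  exact add_le_add (by rw [hpow, mul_left_comm]) (hfderiv x)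

theorem sobolev_exponent_relations {d p r : ℝ} (hp : 1 < p) (hpd : p < d)
    (hr : r⁻¹ = p⁻¹ - d⁻¹) :
    1 < r * (1 - d⁻¹) ∧ r * (1 - d⁻¹) * d.conjExponent = r ∧
      (r * (1 - d⁻¹) - 1) * p.conjExponent = r ∧
      1 / d.conjExponent - 1 / p.conjExponent = 1 / r := by
  have hd : d.HolderConjugate d.conjExponent := .conjExponent (hp.trans hpd)
  have hpq : p.HolderConjugate p.conjExponent := .conjExponent hp
  have hr0 : 0 < r := inv_pos.1 (hr ▸ sub_pos.2 (inv_strictAnti₀ hpq.pos hpd))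
  have hsub : r * (1 - d⁻¹) - 1 = r * p.conjExponent⁻¹ := by
    rw [← hpq.one_sub_inv, ← mul_inv_cancel₀ hr0.ne', hr]
    ring
  refine ⟨sub_pos.1 (hsub ▸ mul_pos hr0 (inv_pos.2 hpq.symm.pos)), ?_, ?_, ?_⟩
  · rw [mul_assoc, hd.one_sub_inv, inv_mul_cancel₀ hd.symm.ne_zero, mul_one]
  · rw [hsub, mul_assoc, inv_mul_cancel₀ hpq.symm.ne_zero, mul_one]
  · simp only [one_div, ← hd.one_sub_inv, ← hpq.one_sub_inv, hr]
    ring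

theorem rpow_lintegral_mul_enorm_add_mul_enorm_le {α E F : Type*} [MeasurableSpace α]
    [NormedAddCommGroup E] [NormedAddCommGroup F] {μ : Measure α} {f : α → E} {g : α → F}
    (hf : AEStronglyMeasurable f μ) (hg : AEStronglyMeasurable g μ) (c c' : ℝ≥0∞) {p : ℝ}
    (hp : 1 ≤ p) :
    (∫⁻ x, (c * ‖f x‖ₑ + c' * ‖g x‖ₑ) ^ p ∂μ) ^ (1 / p) ≤
      c * eLpNorm' f p μ + c' * eLpNorm' g p μ := by
  have hp0 : 0 < p := zero_lt_one.trans_le hp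
  have hscale (c : ℝ≥0∞) {h : α → ℝ≥0∞} (hh : AEMeasurable h μ) :
      (∫⁻ x, (c * h x) ^ p ∂μ) ^ (1 / p) = c * (∫⁻ x, h x ^ p ∂μ) ^ (1 / p) := by
    simp only [ENNReal.mul_rpow_of_nonneg _ _ hp0.le]
    rw [lintegral_const_mul'' _ (hh.pow_const p), ENNReal.mul_rpow_of_nonneg _ _ (by positivity),
      ← ENNReal.rpow_mul, mul_one_div_cancel hp0.ne', ENNReal.rpow_one]
  exact (ENNReal.lintegral_Lp_add_le (hf.enorm.const_mul c) (hg.enorm.const_mul c') hp).trans_eq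
    (congrArg₂ _ (hscale c hf.enorm) (hscale c' hg.enorm))

theorem eLpNorm'_le_eLpNorm'_add_eLpNorm'_fderiv_of_eq {u : (ι → ℝ) → F} (hu : ContDiff ℝ 1 u)
    {p r : ℝ} (hp : 1 < p) (hpd : p < Fintype.card ι)
    (hr : r⁻¹ = p⁻¹ - (Fintype.card ι : ℝ)⁻¹) {a b : ι → ℝ} {ℓ : ℝ} (hℓ : 0 < ℓ)
    (hab : ∀ i, ℓ ≤ b i - a i) :
    eLpNorm' u r (volume.restrict (Set.Icc a b)) ≤
      ENNReal.ofReal ℓ⁻¹ * eLpNorm' u p (volume.restrict (Set.Icc a b)) +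
        ENNReal.ofReal (r * (1 - (Fintype.card ι : ℝ)⁻¹)) *
          eLpNorm' (fderiv ℝ u) p (volume.restrict (Set.Icc a b)) := by
  have hc := hu.continuous
  have hfc : Continuous (fderiv ℝ u) := hu.continuous_fderiv one_ne_zero
  set μ := volume.restrict (Set.Icc a b)
  have hd : (Fintype.card ι : ℝ).HolderConjugate (Fintype.card ι : ℝ).conjExponent :=
    .conjExponent (hp.trans hpd)
  have hpq : p.HolderConjugate p.conjExponent := .conjExponent hp
  obtain ⟨hγ, hγd, hγp, hconj⟩ := sobolev_exponent_relations hp hpd hr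
  set γ := r * (1 - (Fintype.card ι : ℝ)⁻¹)
  have hr0 : 0 < r := hγd ▸ mul_pos (by linarith) hd.symm.pos
  have hHolder := (rpow_setLIntegral_enorm_rpow_le_of_one_lt hu hd hγ hℓ hab).trans
    (ENNReal.lintegral_mul_le_Lp_mul_Lq μ hpq.symm (by fun_prop) (by fun_prop))
  simp only [← ENNReal.rpow_mul, hγp, hγd] at hHolder
  set A := ∫⁻ x, ‖u x‖ₑ ^ r ∂μ with hA
  have hAtop : A ≠ ⊤ := (setLIntegral_enorm_rpow_lt_top hc a b hr0.le).ne
  rcases eq_or_ne A 0 with hA0 | hA0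
  · rw [eLpNorm', ← hA, hA0, ENNReal.zero_rpow_of_pos (one_div_pos.2 hr0)]
    exact zero_le
  rw [eLpNorm', ← hA, ← hconj, ENNReal.rpow_sub _ _ hA0 hAtop]
  exact ENNReal.div_le_of_le_mul' (hHolder.trans (mul_le_mul_right
    (rpow_lintegral_mul_enorm_add_mul_enorm_le hc.aestronglyMeasurable hfc.aestronglyMeasurable
      _ _ hp.le) _))

end Norm

end Box

theorem eLpNorm_mono_exponent_of_measure_univ_le_one {α E : Type*} [MeasurableSpace α]
    [NormedAddCommGroup E] {μ : Measure α} (hμ : μ Set.univ ≤ 1) {p q : ℝ≥0∞} (hpq : p ≤ q)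
    {f : α → E} (hf : AEStronglyMeasurable f μ) : eLpNorm f p μ ≤ eLpNorm f q μ := by
  rcases eq_or_ne p 0 with rfl | hp
  · simp
  refine (eLpNorm_le_eLpNorm_mul_rpow_measure_univ hpq hf).trans
    (mul_le_of_le_one_right' (ENNReal.rpow_le_one hμ (sub_nonneg.2 ?_)))
  simp only [one_div, ← ENNReal.toReal_inv]
  exact ENNReal.toReal_mono (ENNReal.inv_ne_top.2 hp) (ENNReal.inv_le_inv.2 hpq)

theorem exists_subcritical_exponent {d p r : ℝ} (hd : 1 < d) (hp : 1 < p) (hr : 0 < r)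
    (hpr : p⁻¹ - d⁻¹ ≤ r⁻¹) :
    ∃ p' r' : ℝ, 1 < p' ∧ p' < d ∧ p' ≤ p ∧ r ≤ r' ∧ r'⁻¹ = p'⁻¹ - d⁻¹ := by
  have hp0 : 0 < p⁻¹ := by positivity
  have hr0 : 0 < r⁻¹ := by positivity
  have hp1 : p⁻¹ < 1 := inv_lt_one_of_one_lt₀ hp
  have hd1 : d⁻¹ < 1 := inv_lt_one_of_one_lt₀ hd
  obtain ⟨t, hpt, ht1, hdt, htr⟩ : ∃ t, p⁻¹ ≤ t ∧ t < 1 ∧ d⁻¹ < t ∧ t - d⁻¹ ≤ r⁻¹ := by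
    refine ⟨max p⁻¹ (min (r⁻¹ + d⁻¹) ((1 + d⁻¹) / 2)), le_max_left _ _, max_lt hp1 ?_,
      lt_max_of_lt_right (lt_min ?_ ?_), sub_le_iff_le_add.2 (max_le ?_ (min_le_left _ _))⟩
    · exact min_lt_of_right_lt (by linarith)
    all_goals linarith
  have ht0 : 0 < t := hp0.trans_le hpt
  refine ⟨t⁻¹, (t - d⁻¹)⁻¹, (one_lt_inv₀ ht0).2 ht1, inv_lt_of_inv_lt₀ (by linarith) hdt,
    inv_le_of_inv_le₀ (by linarith) hpt, (le_inv_comm₀ hr (sub_pos.2 hdt)).2 htr, ?_⟩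
  rw [inv_inv, inv_inv]

section Box

variable {ι F : Type*} [Fintype ι] [NormedAddCommGroup F]

theorem eLpNorm_top_le_of_unique [Unique ι] [NormedSpace ℝ F] [CompleteSpace F]
    {u : (ι → ℝ) → F} (hu : ContDiff ℝ 1 u) {a b : ι → ℝ} {ℓ : ℝ} (hℓ : 0 < ℓ)
    (hab : ∀ i, ℓ ≤ b i - a i) :
    eLpNorm u ⊤ (volume.restrict (Set.Icc a b)) ≤
      ENNReal.ofReal ℓ⁻¹ * eLpNorm u 1 (volume.restrict (Set.Icc a b)) +
        eLpNorm (fderiv ℝ u) 1 (volume.restrict (Set.Icc a b)) := by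
  classical
  have hc := hu.continuous
  have hline (x : ι → ℝ) (G : (ι → ℝ) → ℝ≥0∞) :
      ∫⁻ t in Set.Icc (a default) (b default), G (Function.update x default t) =
        ∫⁻ y in Set.Icc a b, G y := by
    rw [volume_restrict_Icc_eq_pi, lintegral_eq_lmarginal_univ x, Finset.univ_unique,
      lmarginal_singleton]
  simp only [eLpNorm_exponent_top, eLpNorm_one_eq_lintegral_enorm]
  rw [← lintegral_const_mul _ hc.enorm.measurable,
    ← lintegral_add_left (hc.enorm.measurable.const_mul _)]
  refine eLpNormEssSup_le_of_ae_enorm_bound ?_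
  filter_upwards [ae_restrict_mem measurableSet_Icc] with x hx
  exact (enorm_le_setLIntegral_line hu hℓ hab hx default).trans_eq
    (hline x fun y => ENNReal.ofReal ℓ⁻¹ * ‖u y‖ₑ + ‖fderiv ℝ u y‖ₑ)

variable [Nonempty ι] [InnerProductSpace ℝ F] [CompleteSpace F]

theorem exists_exponents_eLpNorm_Icc_le_of_contDiff {p r ℓ : ℝ} (hp : 1 < p) (hr : 0 < r)
    (hpr : p⁻¹ - (Fintype.card ι : ℝ)⁻¹ ≤ r⁻¹) (hℓ : 0 < ℓ) :
    ∃ p' ≤ ENNReal.ofReal p, ∃ r' ≥ ENNReal.ofReal r, ∃ c c' : ℝ≥0,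
      ∀ a b : ι → ℝ, (∀ i, ℓ ≤ b i - a i) → ∀ u : (ι → ℝ) → F, ContDiff ℝ 1 u →
        eLpNorm u r' (volume.restrict (Set.Icc a b)) ≤
          c * eLpNorm u p' (volume.restrict (Set.Icc a b)) +
            c' * eLpNorm (fderiv ℝ u) p' (volume.restrict (Set.Icc a b)) := by
  rcases Nat.lt_or_ge 1 (Fintype.card ι) with hι | hι
  · obtain ⟨p', r', hp'1, hp'd, hp'p, hrr', heq⟩ :=
      exists_subcritical_exponent (Nat.one_lt_cast.2 hι) hp hr hpr
    refine ⟨.ofReal p', ENNReal.ofReal_le_ofReal hp'p, .ofReal r', ENNReal.ofReal_le_ofReal hrr',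
      ℓ⁻¹.toNNReal, (r' * (1 - (Fintype.card ι : ℝ)⁻¹)).toNNReal, fun a b hab u hu => ?_⟩
    have hp'0 : 0 < p' := by linarith
    have hr'0 : 0 < r' := hr.trans_le hrr'
    rw [eLpNorm_eq_eLpNorm' (by simpa) ENNReal.ofReal_ne_top,
      eLpNorm_eq_eLpNorm' (by simpa) ENNReal.ofReal_ne_top,
      eLpNorm_eq_eLpNorm' (by simpa) ENNReal.ofReal_ne_top,
      ENNReal.toReal_ofReal hr'0.le, ENNReal.toReal_ofReal hp'0.le]
    exact eLpNorm'_le_eLpNorm'_add_eLpNorm'_fderiv_of_eq hu hp'1 hp'd heq hℓ hab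
  · have hcard : Fintype.card ι = 1 := le_antisymm hι Fintype.card_pos
    obtain ⟨_⟩ := Fintype.card_eq_one_iff_nonempty_unique.1 hcard
    refine ⟨1, by simpa using hp.le, ⊤, le_top, ℓ⁻¹.toNNReal, 1, fun a b hab u hu => ?_⟩
    rw [ENNReal.coe_one, one_mul]
    exact eLpNorm_top_le_of_unique hu hℓ hab

theorem exists_eLpNorm_Icc_le_of_contDiff {p r ℓ : ℝ} (hp : 1 < p) (hr : 0 < r)
    (hpr : p⁻¹ - (Fintype.card ι : ℝ)⁻¹ ≤ r⁻¹) (hℓ : 0 < ℓ) :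
    ∃ C : ℝ≥0, ∀ a b : ι → ℝ, (∀ i, ℓ ≤ b i - a i) → volume (Set.Icc a b) ≤ 1 →
      ∀ u : (ι → ℝ) → F, ContDiff ℝ 1 u →
        eLpNorm u (ENNReal.ofReal r) (volume.restrict (Set.Icc a b)) ≤
          C * (eLpNorm u (ENNReal.ofReal p) (volume.restrict (Set.Icc a b)) +
            eLpNorm (fderiv ℝ u) (ENNReal.ofReal p) (volume.restrict (Set.Icc a b))) := by
  obtain ⟨p', hp', r', hr', c, c', h⟩ :=
    exists_exponents_eLpNorm_Icc_le_of_contDiff (ι := ι) (F := F) hp hr hpr hℓ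
  refine ⟨max c c', fun a b hab hvol u hu => ?_⟩
  have hvol' : volume.restrict (Set.Icc a b) Set.univ ≤ 1 := by
    rwa [Measure.restrict_apply_univ]
  have hum := hu.continuous.aestronglyMeasurable (μ := volume.restrict (Set.Icc a b))
  have hfm := (hu.continuous_fderiv one_ne_zero).aestronglyMeasurable
    (μ := volume.restrict (Set.Icc a b))
  refine (eLpNorm_mono_exponent_of_measure_univ_le_one hvol' hr' hum).trans
    ((h a b hab u hu).trans ?_)
  rw [mul_add]
  gcongr
  exacts [le_max_left _ _, eLpNorm_mono_exponent_of_measure_univ_le_one hvol' hp' hum,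
    le_max_right _ _, eLpNorm_mono_exponent_of_measure_univ_le_one hvol' hp' hfm]

end Box

theorem enorm_integral_rpow_le_lintegral {α E : Type*} [MeasurableSpace α] [NormedAddCommGroup E]
    [NormedSpace ℝ E] {π : Measure α} [IsProbabilityMeasure π] {p : ℝ} (hp : 1 ≤ p) (h : α → E) :
    ‖∫ t, h t ∂π‖ₑ ^ p ≤ ∫⁻ t, ‖h t‖ₑ ^ p ∂π := by
  have hp0 : 0 < p := zero_lt_one.trans_le hp
  by_cases hh : AEStronglyMeasurable h π
  · rw [← ENNReal.le_rpow_inv_iff hp0, ← one_div]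
    refine (enorm_integral_le_lintegral_enorm _).trans ?_
    simpa [eLpNorm'] using eLpNorm'_le_eLpNorm'_of_exponent_le one_pos hp π hh
  · rw [integral_non_aestronglyMeasurable hh, enorm_zero, ENNReal.zero_rpow_of_pos hp0]
    exact zero_le

section Convolution

variable {G E : Type*} [AddCommGroup G] [MeasurableSpace G] [MeasurableAdd₂ G] [MeasurableNeg G]
  [NormedAddCommGroup E] [NormedSpace ℝ E] {μ : Measure G} [SFinite μ] [μ.IsAddRightInvariant]
  {p : ℝ} {g : G → E}

theorem eLpNorm'_integral_comp_sub_le (π : Measure G) [IsProbabilityMeasure π] (hp : 1 ≤ p)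
    (hg : AEStronglyMeasurable g μ) :
    eLpNorm' (fun x => ∫ t, g (x - t) ∂π) p μ ≤ eLpNorm' g p μ := by
  have hmeas : AEStronglyMeasurable (fun z : G × G => g (z.1 - z.2)) (μ.prod π) :=
    hg.comp_quasiMeasurePreserving (quasiMeasurePreserving_sub_of_right_invariant μ π)
  refine ENNReal.rpow_le_rpow ?_ (by positivity)
  calc ∫⁻ x, ‖∫ t, g (x - t) ∂π‖ₑ ^ p ∂μ
      ≤ ∫⁻ x, ∫⁻ t, ‖g (x - t)‖ₑ ^ p ∂π ∂μ :=
        lintegral_mono fun x => enorm_integral_rpow_le_lintegral hp _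
    _ = ∫⁻ t, ∫⁻ x, ‖g (x - t)‖ₑ ^ p ∂μ ∂π := lintegral_lintegral_swap (hmeas.enorm.pow_const p)
    _ = ∫⁻ _, ∫⁻ x, ‖g x‖ₑ ^ p ∂μ ∂π :=
        lintegral_congr fun t => lintegral_sub_right_eq_self (fun x => ‖g x‖ₑ ^ p) t
    _ = ∫⁻ x, ‖g x‖ₑ ^ p ∂μ := by simp

theorem eLpNorm'_convolution_le_of_integral_eq_one (hp : 1 ≤ p) {w : G → ℝ} (hw : Measurable w)
    (hw0 : 0 ≤ w) (hw1 : ∫ t, w t ∂μ = 1) (hg : AEStronglyMeasurable g μ) :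
    eLpNorm' (w ⋆[ContinuousLinearMap.lsmul ℝ ℝ, μ] g) p μ ≤ eLpNorm' g p μ := by
  set π : Measure G := μ.withDensity fun t => ENNReal.ofReal (w t)
  have hwi : Integrable w μ := .of_integral_ne_zero (by simp [hw1])
  have : IsProbabilityMeasure π := ⟨by
    rw [withDensity_apply _ .univ, Measure.restrict_univ,
      ← ofReal_integral_eq_lintegral_ofReal hwi (.of_forall hw0), hw1, ENNReal.ofReal_one]⟩
  convert eLpNorm'_integral_comp_sub_le π hp hg using 2
  ext x
  rw [convolution_lsmul, integral_withDensity_eq_integral_toReal_smul (by fun_prop)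
    (.of_forall fun _ => ENNReal.ofReal_lt_top)]
  simp only [ENNReal.toReal_ofReal (hw0 _)]

end Convolution

theorem openCube_subset_cube (d : ℕ) : openCube d ⊆ cube d :=
  fun _ hx => ⟨fun i => (hx i trivial).1.le, fun i => (hx i trivial).2.le⟩

theorem measurableSet_cube (d : ℕ) : MeasurableSet (cube d) := measurableSet_Icc

theorem ae_mem_openCube (d : ℕ) : ∀ᵐ x ∂unif d, x ∈ openCube d := by
  have h : (openCube d : Set (Fin d → ℝ)) =ᵐ[volume] cube d :=
    Measure.univ_pi_Ioo_ae_eq_Icc (μ := fun _ => volume) (f := 0) (g := 1)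
  rw [unif, ← Measure.restrict_congr_set h]
  exact ae_restrict_mem (MeasurableSet.univ_pi fun _ => measurableSet_Ioo)

theorem volume_cube (d : ℕ) : volume (cube d) = 1 := by
  rw [cube, Real.volume_Icc_pi]
  simp

instance (d : ℕ) : IsProbabilityMeasure (unif d) :=
  ⟨by rw [unif, Measure.restrict_apply_univ, volume_cube]⟩

variable {d : ℕ}

/-- The closed cube of points of `Ω` at sup-distance at least `δ` from the complement of `Ω`. On it,
mollification at a scale smaller than `δ` only sees values of a function inside the open cube. -/
def innerCube (d : ℕ) (δ : ℝ) : Set (Fin d → ℝ) := Set.Icc (fun _ => δ) fun _ => 1 - δ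

theorem measurableSet_innerCube (d : ℕ) (δ : ℝ) : MeasurableSet (innerCube d δ) :=
  measurableSet_Icc

theorem innerCube_subset_cube {δ : ℝ} (hδ : 0 ≤ δ) : innerCube d δ ⊆ cube d :=
  Set.Icc_subset_Icc (fun _ => hδ) fun _ => sub_le_self 1 hδ

theorem closedBall_subset_openCube {x : Fin d → ℝ} {ε δ : ℝ} (hεδ : ε < δ)
    (hx : x ∈ innerCube d δ) : Metric.closedBall x ε ⊆ openCube d := by
  intro y hy j _
  have hyx := abs_le.1 ((dist_le_pi_dist y x j).trans hy)
  have hl : δ ≤ x j := hx.1 j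
  have hu : x j ≤ 1 - δ := hx.2 j
  constructor <;> linarith

/-- Convolution of a function on `Ω`, extended by zero, with the normalized bump `ρ`. -/
noncomputable def mollify (ρ : ContDiffBump (0 : Fin d → ℝ)) (f : (Fin d → ℝ) → ℝ) :
    (Fin d → ℝ) → ℝ :=
  ρ.normed volume ⋆[ContinuousLinearMap.lsmul ℝ ℝ, volume] (cube d).indicator f

section Mollify

variable {ρ : ContDiffBump (0 : Fin d → ℝ)} {f g : (Fin d → ℝ) → ℝ}

theorem locallyIntegrable_indicator_cube (hf : Integrable f (unif d)) :
    LocallyIntegrable ((cube d).indicator f) :=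
  ((integrable_indicator_iff (measurableSet_cube d)).2 hf).locallyIntegrable

theorem mollify_apply (x : Fin d → ℝ) :
    mollify ρ f x = ∫ y in cube d, ρ.normed volume (x - y) * f y := by
  rw [mollify, convolution_lsmul_swap, ← integral_indicator (measurableSet_cube d)]
  simp only [Set.indicator_mul_right, smul_eq_mul]

theorem contDiff_mollify (hf : Integrable f (unif d)) : ContDiff ℝ ∞ (mollify ρ f) :=
  ρ.hasCompactSupport_normed.contDiff_convolution_left _ ρ.contDiff_normed
    (locallyIntegrable_indicator_cube hf)

theorem fderiv_mollify_apply (hf : Integrable f (unif d)) (x v : Fin d → ℝ) :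
    fderiv ℝ (mollify ρ f) x v =
      ∫ y in cube d, fderiv ℝ (ρ.normed volume) (x - y) v * f y := by
  have hw : ContDiff ℝ 1 (ρ.normed volume) := ρ.contDiff_normed
  have hfi := locallyIntegrable_indicator_cube hf
  have hinteg := ((ρ.hasCompactSupport_normed (μ := volume)).fderiv ℝ).convolutionExists_left
    ((ContinuousLinearMap.lsmul ℝ ℝ).precompL (Fin d → ℝ)) (hw.continuous_fderiv one_ne_zero)
    hfi x
  rw [mollify, (ρ.hasCompactSupport_normed.hasFDerivAt_convolution_left
    (ContinuousLinearMap.lsmul ℝ ℝ) hw hfi x).fderiv, convolution_eq_swap,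
    ContinuousLinearMap.integral_apply hinteg.integrable_swap,
    ← integral_indicator (measurableSet_cube d)]
  simp only [ContinuousLinearMap.precompL_apply, ContinuousLinearMap.lsmul_apply, smul_eq_mul,
    Set.indicator_mul_right]

theorem isTestFunction_normed_sub {x : Fin d → ℝ}
    (hx : Metric.closedBall x ρ.rOut ⊆ openCube d) :
    IsTestFunction fun y => ρ.normed volume (x - y) := by
  have hsupp : (Function.support fun y => ρ.normed volume (x - y)) ⊆
      Metric.closedBall x ρ.rOut := by
    intro y hy
    have hxy : x - y ∈ Function.support (ρ.normed volume) := hy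
    rw [ρ.support_normed_eq, mem_ball_zero_iff] at hxy
    rw [Metric.mem_closedBall, dist_comm, dist_eq_norm]
    exact hxy.le
  exact ⟨ρ.contDiff_normed.comp (contDiff_const.sub contDiff_id),
    .of_support_subset_isCompact (isCompact_closedBall x ρ.rOut) hsupp,
    (closure_minimal hsupp Metric.isClosed_closedBall).trans hx⟩

theorem partialDeriv_single (i : Fin d) (φ : (Fin d → ℝ) → ℝ) (x : Fin d → ℝ) :
    partialDeriv (fun _ : Fin 1 => i) φ x = fderiv ℝ φ x (Pi.single i 1) :=
  iteratedFDeriv_one_apply _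

theorem fderiv_mollify_single (hf : Integrable f (unif d)) {i : Fin d}
    (hfg : IsWeakDeriv (fun _ : Fin 1 => i) f g) {x : Fin d → ℝ}
    (hx : Metric.closedBall x ρ.rOut ⊆ openCube d) :
    fderiv ℝ (mollify ρ f) x (Pi.single i 1) = mollify ρ g x := by
  have hreflect (y : Fin d → ℝ) : fderiv ℝ (fun y => ρ.normed volume (x - y)) y =
      -fderiv ℝ (ρ.normed volume) (x - y) := by
    have hsub : HasFDerivAt (fun y => x - y) (-ContinuousLinearMap.id ℝ (Fin d → ℝ)) y := by
      simpa using (hasFDerivAt_id (𝕜 := ℝ) y).const_sub x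
    have hnormed := (ρ.contDiff_normed (μ := volume) (n := 1)).differentiable one_ne_zero (x - y)
    simpa [Function.comp_def] using (hnormed.hasFDerivAt.comp y hsub).fderiv
  have hweak := hfg _ (isTestFunction_normed_sub hx)
  simp only [partialDeriv_single, hreflect, neg_apply, mul_neg, integral_neg,
    pow_one, neg_mul, one_mul, neg_inj] at hweak
  rw [fderiv_mollify_apply hf, mollify_apply]
  simpa only [mul_comm] using hweak

theorem eLpNorm_mollify_le {p : ℝ} (hp : 1 ≤ p) (hf : Integrable f (unif d)) :
    eLpNorm (mollify ρ f) (ENNReal.ofReal p) volume ≤ eLpNorm f (ENNReal.ofReal p) (unif d) := by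
  rw [unif, ← eLpNorm_indicator_eq_eLpNorm_restrict (measurableSet_cube d),
    eLpNorm_eq_eLpNorm' (by simpa using zero_lt_one.trans_le hp) ENNReal.ofReal_ne_top,
    eLpNorm_eq_eLpNorm' (by simpa using zero_lt_one.trans_le hp) ENNReal.ofReal_ne_top,
    ENNReal.toReal_ofReal (zero_le_one.trans hp)]
  exact eLpNorm'_convolution_le_of_integral_eq_one hp ρ.continuous_normed.measurable
    ρ.nonneg_normed ρ.integral_normed (locallyIntegrable_indicator_cube hf).aestronglyMeasurable

end Mollify

theorem enorm_le_sum_enorm_apply_single {ι F : Type*} [Fintype ι] [DecidableEq ι]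
    [NormedAddCommGroup F] [NormedSpace ℝ F] (L : (ι → ℝ) →L[ℝ] F) :
    ‖L‖ₑ ≤ ∑ i, ‖L (Pi.single i 1)‖ₑ := by
  refine L.opENorm_le_bound fun v => ?_
  calc ‖L v‖ₑ = ‖∑ i, v i • L (Pi.single i 1)‖ₑ := by
        conv_lhs => rw [pi_eq_sum_univ' v, map_sum]
        simp only [map_smul]
    _ ≤ ∑ i, ‖v i • L (Pi.single i 1)‖ₑ := enorm_sum_le _ _
    _ ≤ ∑ i, ‖L (Pi.single i 1)‖ₑ * ‖v‖ₑ := by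
        refine Finset.sum_le_sum fun i _ => ?_
        rw [enorm_smul, mul_comm]
        gcongr
        exact enorm_le_iff_norm_le.2 (norm_le_pi_norm v i)
    _ = (∑ i, ‖L (Pi.single i 1)‖ₑ) * ‖v‖ₑ := by rw [Finset.sum_mul]

theorem eLpNorm_fderiv_mollify_le {ρ : ContDiffBump (0 : Fin d → ℝ)} {f : (Fin d → ℝ) → ℝ}
    {g : Fin d → (Fin d → ℝ) → ℝ} {p δ : ℝ} (hp : 1 ≤ p) (hf : Integrable f (unif d))
    (hg : ∀ i, Integrable (g i) (unif d)) (hfg : ∀ i, IsWeakDeriv (fun _ : Fin 1 => i) f (g i))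
    (hρ : ρ.rOut < δ) :
    eLpNorm (fderiv ℝ (mollify ρ f)) (ENNReal.ofReal p) (volume.restrict (innerCube d δ)) ≤
      ∑ i, eLpNorm (g i) (ENNReal.ofReal p) (unif d) := by
  have hfderiv (x) (hx : x ∈ innerCube d δ) :
      ‖fderiv ℝ (mollify ρ f) x‖ₑ ≤ ‖(∑ i, fun x => ‖mollify ρ (g i) x‖) x‖ₑ := by
    refine (enorm_le_sum_enorm_apply_single _).trans_eq ?_
    rw [Finset.sum_apply, Real.enorm_of_nonneg (by positivity),
      ENNReal.ofReal_sum_of_nonneg fun _ _ => norm_nonneg _]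
    refine Finset.sum_congr rfl fun i _ => ?_
    rw [fderiv_mollify_single hf (hfg i) (closedBall_subset_openCube hρ hx), ofReal_norm]
  calc eLpNorm (fderiv ℝ (mollify ρ f)) (ENNReal.ofReal p) (volume.restrict (innerCube d δ))
      ≤ eLpNorm (∑ i, fun x => ‖mollify ρ (g i) x‖) (ENNReal.ofReal p)
          (volume.restrict (innerCube d δ)) :=
        eLpNorm_mono_enorm_ae <| (ae_restrict_mem (measurableSet_innerCube d δ)).mono hfderiv
    _ ≤ eLpNorm (∑ i, fun x => ‖mollify ρ (g i) x‖) (ENNReal.ofReal p) volume :=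
        eLpNorm_restrict_le ..
    _ ≤ ∑ i, eLpNorm (fun x => ‖mollify ρ (g i) x‖) (ENNReal.ofReal p) volume :=
        eLpNorm_sum_le (fun i _ => (contDiff_mollify (hg i)).continuous.norm.aestronglyMeasurable)
          (by simpa using hp)
    _ ≤ ∑ i, eLpNorm (g i) (ENNReal.ofReal p) (unif d) :=
        Finset.sum_le_sum fun i _ => (eLpNorm_norm _).trans_le (eLpNorm_mollify_le hp (hg i))

theorem eventually_mem_innerCube {x : Fin d → ℝ} (hx : x ∈ openCube d) :
    ∀ᶠ δ in 𝓝 0, x ∈ innerCube d δ := by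
  have hcoord (i : Fin d) : ∀ᶠ δ in 𝓝 0, δ < x i ∧ δ < 1 - x i :=
    (gt_mem_nhds (hx i trivial).1).and (gt_mem_nhds (sub_pos.2 (hx i trivial).2))
  filter_upwards [Filter.eventually_all.2 hcoord] with δ hδ
  exact ⟨fun i => (hδ i).1.le, fun i => by linarith [(hδ i).2]⟩

theorem ae_tendsto_indicator_mollify {f : (Fin d → ℝ) → ℝ} (hf : Integrable f (unif d))
    {ρ : ℕ → ContDiffBump (0 : Fin d → ℝ)} {δ : ℕ → ℝ} {c : ℝ}
    (hδ : Filter.Tendsto δ Filter.atTop (𝓝 0))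
    (hρ : Filter.Tendsto (fun n => (ρ n).rOut) Filter.atTop (𝓝 0))
    (hρc : ∀ n, (ρ n).rOut ≤ c * (ρ n).rIn) :
    ∀ᵐ x ∂unif d, Filter.Tendsto (fun n => (innerCube d (δ n)).indicator (mollify (ρ n) f) x)
      Filter.atTop (𝓝 (f x)) := by
  have hlim := ContDiffBump.ae_convolution_tendsto_right_of_locallyIntegrable hρ
    (.of_forall hρc) (locallyIntegrable_indicator_cube hf)
  filter_upwards [ae_mem_openCube d, ae_restrict_of_ae hlim] with x hx hxlim
  rw [Set.indicator_of_mem (openCube_subset_cube d hx)] at hxlim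
  refine hxlim.congr' ?_
  filter_upwards [hδ.eventually (eventually_mem_innerCube hx)] with n hn
  rw [Set.indicator_of_mem hn, mollify]

/-- The bump used to mollify at scale `1 / n`, supported within distance `δ / 2` of the origin for
`δ = (n + 4)⁻¹`. The shift by `4` leaves the inner cube of margin `δ` with sides of length at least
`1 / 2`. -/
noncomputable def shrinkingBump (d n : ℕ) : ContDiffBump (0 : Fin d → ℝ) where
  rIn := ((n : ℝ) + 4)⁻¹ / 4
  rOut := ((n : ℝ) + 4)⁻¹ / 2
  rIn_pos := by positivity
  rIn_lt_rOut := by gcongr; norm_num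

theorem exists_eLpNorm_le_of_isWeakDeriv (hd : 0 < d) {p r : ℝ} (hp : 1 < p) (hr : 0 < r)
    (hpr : p⁻¹ - (d : ℝ)⁻¹ ≤ r⁻¹) :
    ∃ C : ℝ≥0, ∀ (f : (Fin d → ℝ) → ℝ) (g : Fin d → (Fin d → ℝ) → ℝ),
      MemLp f (ENNReal.ofReal p) (unif d) → (∀ i, MemLp (g i) (ENNReal.ofReal p) (unif d)) →
      (∀ i, IsWeakDeriv (fun _ : Fin 1 => i) f (g i)) →
      eLpNorm f (ENNReal.ofReal r) (unif d) ≤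
        C * (eLpNorm f (ENNReal.ofReal p) (unif d) +
          ∑ i, eLpNorm (g i) (ENNReal.ofReal p) (unif d)) := by
  have : NeZero d := ⟨hd.ne'⟩
  obtain ⟨C, hC⟩ := exists_eLpNorm_Icc_le_of_contDiff (ι := Fin d) (F := ℝ) hp hr
    (by rwa [Fintype.card_fin]) one_half_pos
  refine ⟨C, fun f g hf hg hfg => ?_⟩
  have hp1 : 1 ≤ ENNReal.ofReal p := by simpa using hp.le
  have hfi : Integrable f (unif d) := hf.integrable hp1
  set δ : ℕ → ℝ := fun n => ((n : ℝ) + 4)⁻¹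
  have hδ0 (n : ℕ) : 0 < δ n := by positivity
  have hδ4 (n : ℕ) : δ n ≤ 4⁻¹ := inv_anti₀ four_pos (by simp)
  have hδlim : Filter.Tendsto δ Filter.atTop (𝓝 0) :=
    (tendsto_natCast_atTop_atTop.atTop_add tendsto_const_nhds).inv_tendsto_atTop
  have hbound (n : ℕ) :
      eLpNorm ((innerCube d (δ n)).indicator (mollify (shrinkingBump d n) f))
        (ENNReal.ofReal r) (unif d) ≤ C * (eLpNorm f (ENNReal.ofReal p) (unif d) +
          ∑ i, eLpNorm (g i) (ENNReal.ofReal p) (unif d)) := by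
    rw [eLpNorm_indicator_eq_eLpNorm_restrict (measurableSet_innerCube d _)]
    have hle : (unif d).restrict (innerCube d (δ n)) ≤ volume.restrict (innerCube d (δ n)) :=
      Measure.restrict_mono_measure Measure.restrict_le_self _
    have hvol : volume (innerCube d (δ n)) ≤ 1 :=
      (measure_mono (innerCube_subset_cube (hδ0 n).le)).trans_eq (volume_cube d)
    calc _ ≤ _ := eLpNorm_mono_measure _ hle
      _ ≤ _ := hC _ _ (fun _ => by linarith [hδ4 n]) hvol _ ((contDiff_mollify hfi).of_le (by simp))
      _ ≤ _ := by
        gcongr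
        · exact (eLpNorm_restrict_le ..).trans (eLpNorm_mollify_le hp.le hfi)
        · exact eLpNorm_fderiv_mollify_le hp.le hfi (fun i => (hg i).integrable hp1) hfg
            (half_lt_self (hδ0 n))
  refine Lp.eLpNorm_le_of_ae_tendsto (.of_forall hbound) (fun n => ?_)
    (ae_tendsto_indicator_mollify (c := 2) hfi hδlim
      (by simpa [shrinkingBump] using hδlim.div_const 2) fun n => ?_)
  · exact (contDiff_mollify hfi).continuous.aestronglyMeasurable.indicator
      (measurableSet_innerCube d _)
  · simp only [shrinkingBump]
    linarith

section Sobolev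

variable {d s k : ℕ}

theorem IsTestFunction.fderiv_apply {φ : (Fin d → ℝ) → ℝ} (hφ : IsTestFunction φ)
    (v : Fin d → ℝ) : IsTestFunction fun y => fderiv ℝ φ y v := by
  refine ⟨(hφ.1.fderiv_right (m := ∞) (by simp)).clm_apply contDiff_const,
    hφ.2.1.fderiv_apply ℝ v, subset_trans (closure_mono fun y hy => ?_)
      ((tsupport_fderiv_subset ℝ (f := φ)).trans hφ.2.2)⟩
  contrapose! hy
  simp_all

theorem partialDeriv_snoc (i : Fin k → Fin d) (j : Fin d) {φ : (Fin d → ℝ) → ℝ}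
    (hφ : ContDiff ℝ ∞ φ) (x : Fin d → ℝ) :
    partialDeriv (Fin.snoc i j : Fin (k + 1) → Fin d) φ x =
      partialDeriv i (fun y => fderiv ℝ φ y (Pi.single j 1)) x := by
  have hcomp := (ContinuousLinearMap.apply ℝ ℝ (Pi.single j 1 : Fin d → ℝ)).iteratedFDeriv_comp_left
    (f := fderiv ℝ φ) (x := x) (n := ∞) (i := k)
    (hφ.fderiv_right (m := ∞) (by simp)).contDiffAt (by exact_mod_cast le_top)
  rw [partialDeriv, iteratedFDeriv_succ_apply_right, partialDeriv]
  simpa [Function.comp_def, Fin.init_def] using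
    DFunLike.congr_fun hcomp.symm fun j => Pi.single (i j) 1

theorem IsWeakDeriv.snoc {i : Fin k → Fin d} {j : Fin d} {f g g' : (Fin d → ℝ) → ℝ}
    (hg : IsWeakDeriv i f g) (hg' : IsWeakDeriv (Fin.snoc i j : Fin (k + 1) → Fin d) f g') :
    IsWeakDeriv (fun _ : Fin 1 => j) g g' := by
  intro φ hφ
  have hgφ := hg _ (hφ.fderiv_apply (Pi.single j 1))
  have hgφ' := hg' φ hφ
  simp only [partialDeriv_snoc i j hφ.1] at hgφ'
  simp only [partialDeriv_single]
  rw [hgφ, pow_succ, mul_assoc] at hgφ'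
  rw [pow_one]
  exact mul_left_cancel₀ (pow_ne_zero k (by simp)) hgφ'

theorem IsTestFunction.setIntegral_cube_mul {φ : (Fin d → ℝ) → ℝ} (hφ : IsTestFunction φ)
    (f : (Fin d → ℝ) → ℝ) : ∫ x in cube d, f x * φ x = ∫ x, f x * φ x := by
  refine setIntegral_eq_integral_of_forall_compl_eq_zero fun x hx => ?_
  rw [image_eq_zero_of_notMem_tsupport fun h => hx (openCube_subset_cube d (hφ.2.2 h)), mul_zero]

theorem IsWeakDeriv.ae_eq {i : Fin 0 → Fin d} {f g : (Fin d → ℝ) → ℝ}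
    (hf : Integrable f (unif d)) (hg : Integrable g (unif d)) (h : IsWeakDeriv i f g) :
    f =ᵐ[unif d] g := by
  have hopen : IsOpen (openCube d) := isOpen_set_pi Set.finite_univ fun _ _ => isOpen_Ioo
  have hloc : LocallyIntegrableOn (f - g) (openCube d) :=
    (IntegrableOn.mono_set (hf.sub hg) (openCube_subset_cube d)).locallyIntegrableOn
  have hzero : ∀ᵐ x, x ∈ openCube d → (f - g) x = 0 := by
    refine hopen.ae_eq_zero_of_integral_contDiff_smul_eq_zero hloc fun φ hφ hφc hφs => ?_
    obtain ⟨B, hB⟩ := hφc.exists_bound_of_continuous hφ.continuous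
    have hinteg {h : (Fin d → ℝ) → ℝ} (hh : Integrable h (unif d)) :
        Integrable (fun x => h x * φ x) (unif d) :=
      hh.mul_bdd hφ.continuous.aestronglyMeasurable (.of_forall hB)
    have hweak := h φ ⟨hφ, hφc, hφs⟩
    simp only [partialDeriv, iteratedFDeriv_zero_apply, pow_zero, one_mul] at hweak
    calc ∫ x, φ x • (f - g) x = ∫ x, (f - g) x * φ x := by simp only [smul_eq_mul, mul_comm]
      _ = ∫ x in cube d, (f - g) x * φ x :=
        (IsTestFunction.setIntegral_cube_mul ⟨hφ, hφc, hφs⟩ _).symm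
      _ = ∫ x in cube d, (f x * φ x - g x * φ x) := by simp only [Pi.sub_apply, sub_mul]
      _ = 0 := (integral_sub (hinteg hf) (hinteg hg)).trans (sub_eq_zero.2 hweak)
  filter_upwards [ae_mem_openCube d, ae_restrict_of_ae hzero] with x hx hx0
  exact sub_eq_zero.1 (hx0 hx)

theorem exists_sobolevBall_succ_subset (hd : 0 < d) (s : ℕ) {p r : ℝ} (hp : 1 < p) (hr : 0 < r)
    (hpr : p⁻¹ - (d : ℝ)⁻¹ ≤ r⁻¹) (R : ℝ) :
    ∃ R', sobolevBall d (s + 1) p R ⊆ sobolevBall d s r R' := by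
  obtain ⟨C, hC⟩ := exists_eLpNorm_le_of_isWeakDeriv hd hp hr hpr
  refine ⟨C * ((1 + d) * R), fun f hf => ?_⟩
  have hmem {f : (Fin d → ℝ) → ℝ} {g : Fin d → (Fin d → ℝ) → ℝ}
      (hf : MemLp f (ENNReal.ofReal p) (unif d)) (hg : ∀ i, MemLp (g i) (ENNReal.ofReal p) (unif d))
      (hfg : ∀ i, IsWeakDeriv (fun _ : Fin 1 => i) f (g i)) :
      MemLp f (ENNReal.ofReal r) (unif d) :=
    ⟨hf.1, (hC f g hf hg hfg).trans_lt <| ENNReal.mul_lt_top ENNReal.coe_lt_top <|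
      ENNReal.add_lt_top.2 ⟨hf.2, ENNReal.sum_lt_top.2 fun i _ => (hg i).2⟩⟩
  refine ⟨?_, fun k hk i => ?_⟩
  · choose g hgL hfg _ using fun i : Fin d => hf.2 1 (by lia) fun _ => i
    exact hmem hf.1 hgL hfg
  · obtain ⟨g, hgL, hfg, hgR⟩ := hf.2 k (by lia) i
    choose g' hgL' hfg' hgR' using fun j : Fin d => hf.2 (k + 1) (by lia) (Fin.snoc i j)
    have hgg' (j : Fin d) : IsWeakDeriv (fun _ : Fin 1 => j) g (g' j) := hfg.snoc (hfg' j)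
    refine ⟨g, hmem hgL hgL' hgg', hfg, ?_⟩
    calc _ ≤ C * (eLpNorm g (ENNReal.ofReal p) (unif d) +
          ∑ j, eLpNorm (g' j) (ENNReal.ofReal p) (unif d)) := hC g g' hgL hgL' hgg'
      _ ≤ C * (ENNReal.ofReal R + ∑ _j : Fin d, ENNReal.ofReal R) := by
        gcongr with j
        exact hgR' j
      _ = ENNReal.ofReal (C * ((1 + d) * R)) := by
        rw [ENNReal.ofReal_mul C.coe_nonneg, ENNReal.ofReal_coe_nnreal,
          ENNReal.ofReal_mul (by positivity), ENNReal.ofReal_add zero_le_one (by positivity)]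
        simp [add_mul]

theorem exists_eLpNorm_le_of_mem_sobolevBall (hd : 0 < d) (s : ℕ) {p r : ℝ} (hp : 1 < p)
    (hr : 1 < r) (hpr : p⁻¹ - (s : ℝ) / d ≤ r⁻¹) (R : ℝ) :
    ∃ C : ℝ, ∀ f ∈ sobolevBall d s p R,
      eLpNorm f (ENNReal.ofReal r) (unif d) ≤ ENNReal.ofReal C := by
  induction s generalizing p R with
  | zero =>
    refine ⟨R, fun f hf => ?_⟩
    obtain ⟨g, hgL, hfg, hgR⟩ := hf.2 0 le_rfl Fin.elim0
    have hp1 : 1 ≤ ENNReal.ofReal p := by simpa using hp.le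
    have hrp : r ≤ p := by
      rw [← inv_le_inv₀ (by positivity) (by positivity)]
      simpa using hpr
    rw [eLpNorm_congr_ae (hfg.ae_eq (hf.1.integrable hp1) (hgL.integrable hp1))]
    exact (eLpNorm_le_eLpNorm_of_exponent_le (ENNReal.ofReal_le_ofReal hrp) hgL.1).trans hgR
  | succ s ih =>
    -- One order of smoothness is spent on raising the exponent from `p` to `1 / t`.
    set t := max (p⁻¹ - (d : ℝ)⁻¹) r⁻¹
    have ht0 : 0 < t := lt_max_of_lt_right (by positivity)
    have ht1 : 1 < t⁻¹ := by
      have : (0 : ℝ) ≤ (d : ℝ)⁻¹ := by positivity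
      exact (one_lt_inv₀ ht0).2 (max_lt (by linarith [inv_lt_one_of_one_lt₀ hp])
        (inv_lt_one_of_one_lt₀ hr))
    have htr : t - (s : ℝ) / d ≤ r⁻¹ := by
      rw [sub_le_iff_le_add]
      refine max_le ?_ (le_add_of_nonneg_right (by positivity))
      rw [Nat.cast_add_one, add_div, one_div] at hpr
      linarith
    obtain ⟨R', hR'⟩ := exists_sobolevBall_succ_subset hd s hp (zero_lt_one.trans ht1)
      ((le_max_left _ _).trans_eq (inv_inv t).symm) R
    obtain ⟨C, hC⟩ := ih ht1 (by rwa [inv_inv]) R'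
    exact ⟨C, fun f hf => hC f (hR' hf)⟩

theorem exists_mem_sobolevBall {p : ℝ} {f : (Fin d → ℝ) → ℝ} (hf : f ∈ sobolev d s p) :
    ∃ R, f ∈ sobolevBall d s p R := by
  choose g hgL hfg using fun (k : Fin (s + 1)) (i : Fin k → Fin d) => hf.2 k (by lia) i
  obtain ⟨R, hR⟩ := (Set.finite_range fun z : (k : Fin (s + 1)) × (Fin k → Fin d) =>
    (eLpNorm (g z.1 z.2) (ENNReal.ofReal p) (unif d)).toReal).bddAbove
  refine ⟨R, hf.1, fun k hk i => ?_⟩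
  let k' : Fin (s + 1) := ⟨k, by lia⟩
  refine ⟨g k' i, hgL k' i, hfg k' i, ?_⟩
  exact ENNReal.le_ofReal_iff_toReal_le (hgL k' i).2.ne
    (ENNReal.toReal_nonneg.trans (hR ⟨⟨k', i⟩, rfl⟩)) |>.2 (hR ⟨⟨k', i⟩, rfl⟩)

theorem sobolevBall_subset_sobolev (d s : ℕ) (p R : ℝ) : sobolevBall d s p R ⊆ sobolev d s p :=
  fun _ hf => ⟨hf.1, fun k hk i => let ⟨g, hgL, hfg, _⟩ := hf.2 k hk i; ⟨g, hgL, hfg⟩⟩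

theorem memLp_of_mem_sobolev (hd : 0 < d) {p r : ℝ} (hp : 1 < p) (hr : 1 < r)
    (hpr : p⁻¹ - (s : ℝ) / d ≤ r⁻¹) {f : (Fin d → ℝ) → ℝ} (hf : f ∈ sobolev d s p) :
    MemLp f (ENNReal.ofReal r) (unif d) := by
  obtain ⟨R, hR⟩ := exists_mem_sobolevBall hf
  obtain ⟨C, hC⟩ := exists_eLpNorm_le_of_mem_sobolevBall hd s hp hr hpr R
  exact ⟨hf.1.1, (hC f hR).trans_lt ENNReal.ofReal_lt_top⟩

end Sobolev

section MonteCarlo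

open ProbabilityTheory

variable {Ω α β ι : Type*} [MeasurableSpace Ω] [MeasurableSpace α] [MeasurableSpace β] [Fintype ι]

theorem lintegral_enorm_sub_integral_le_evariance {π : Measure Ω} [IsProbabilityMeasure π]
    {X : Ω → ℝ} (hX : AEStronglyMeasurable X π) :
    ∫⁻ t, ‖X t - ∫ u, X u ∂π‖ₑ ∂π ≤ eVar[X; π] ^ (1 / 2 : ℝ) := by
  simpa [eLpNorm', evariance] using eLpNorm'_le_eLpNorm'_of_exponent_le one_pos one_le_two π
    (hX.sub aestronglyMeasurable_const)

theorem evariance_le_eLpNorm_sq {π : Measure Ω} [IsProbabilityMeasure π] {X : Ω → ℝ}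
    (hX : AEStronglyMeasurable X π) : eVar[X; π] ≤ eLpNorm X 2 π ^ 2 := by
  have hsq : eLpNorm X 2 π ^ 2 = ∫⁻ t, ‖X t‖ₑ ^ 2 ∂π := by
    simpa using eLpNorm_nnreal_pow_eq_lintegral (f := X) (μ := π) (two_ne_zero (α := ℝ≥0))
  rw [evariance_def' hX, hsq]
  exact tsub_le_self

variable {μ : Measure β} [IsProbabilityMeasure μ] {h : β → ℝ}

theorem variance_average_pi (hh : MemLp h 2 μ) :
    Var[fun y : ι → β => (Fintype.card ι : ℝ)⁻¹ * ∑ i, h (y i); Measure.pi fun _ => μ] =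
      (Fintype.card ι : ℝ)⁻¹ * Var[h; μ] := by
  have hsum : Var[fun y : ι → β => ∑ i, h (y i); Measure.pi fun _ => μ] =
      Fintype.card ι * Var[h; μ] := by
    have hpi := variance_sum_pi (μ := fun _ : ι => μ) (X := fun _ => h) fun _ => hh
    simpa [Finset.sum_fn] using hpi
  rw [variance_const_mul, hsum]
  rcases eq_or_ne (Fintype.card ι : ℝ) 0 with h0 | h0
  · simp [h0]
  · field_simp

theorem integral_average_pi [Nonempty ι] (hh : Integrable h μ) :
    ∫ y : ι → β, (Fintype.card ι : ℝ)⁻¹ * ∑ i, h (y i) ∂Measure.pi (fun _ => μ) =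
      ∫ z, h z ∂μ := by
  have heval (i : ι) : ∫ y : ι → β, h (y i) ∂Measure.pi (fun _ => μ) = ∫ z, h z ∂μ :=
    integral_comp_eval (μ := fun _ => μ) hh.1
  rw [integral_const_mul, integral_finsetSum _ fun i _ => integrable_comp_eval hh]
  simp [heval]

theorem memLp_average_pi {p : ℝ≥0∞} (hh : MemLp h p μ) :
    MemLp (fun y : ι → β => (Fintype.card ι : ℝ)⁻¹ * ∑ i, h (y i)) p (Measure.pi fun _ => μ) :=
  (memLp_finsetSum _ fun i _ =>
    hh.comp_measurePreserving (measurePreserving_eval (fun _ : ι => μ) i)).const_mul _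

theorem lintegral_enorm_average_sub_integral_le [Nonempty ι] (hh : MemLp h 2 μ) :
    ∫⁻ y, ‖(Fintype.card ι : ℝ)⁻¹ * ∑ i, h (y i) - ∫ z, h z ∂μ‖ₑ ∂Measure.pi (fun _ : ι => μ) ≤
      ENNReal.ofReal ((Fintype.card ι : ℝ) ^ (-(1 / 2) : ℝ)) * eLpNorm h 2 μ := by
  set A : (ι → β) → ℝ := fun y => (Fintype.card ι : ℝ)⁻¹ * ∑ i, h (y i)
  have hA : MemLp A 2 (Measure.pi fun _ => μ) := memLp_average_pi hh
  have hcard : (0 : ℝ) < (Fintype.card ι : ℝ)⁻¹ := by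
    have := Fintype.card_pos (α := ι)
    positivity
  rw [← integral_average_pi (ι := ι) (hh.integrable one_le_two)]
  calc ∫⁻ y, ‖A y - ∫ y, A y ∂Measure.pi fun _ => μ‖ₑ ∂Measure.pi (fun _ => μ)
      ≤ eVar[A; Measure.pi fun _ => μ] ^ (1 / 2 : ℝ) :=
        lintegral_enorm_sub_integral_le_evariance hA.1
    _ = (ENNReal.ofReal (Fintype.card ι : ℝ)⁻¹ * eVar[h; μ]) ^ (1 / 2 : ℝ) := by
        rw [← hA.ofReal_variance_eq, variance_average_pi hh, ENNReal.ofReal_mul hcard.le,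
          hh.ofReal_variance_eq]
    _ ≤ (ENNReal.ofReal (Fintype.card ι : ℝ)⁻¹ * eLpNorm h 2 μ ^ 2) ^ (1 / 2 : ℝ) := by
        gcongr
        exact evariance_le_eLpNorm_sq hh.1
    _ = ENNReal.ofReal ((Fintype.card ι : ℝ) ^ (-(1 / 2) : ℝ)) * eLpNorm h 2 μ := by
        rw [ENNReal.mul_rpow_of_nonneg _ _ (by norm_num), ENNReal.ofReal_rpow_of_pos hcard,
          Real.inv_rpow (Nat.cast_nonneg _), Real.rpow_neg (Nat.cast_nonneg _),
          ← ENNReal.rpow_natCast_mul]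
        norm_num

variable {ν : Measure α} [IsProbabilityMeasure ν] {H : α × β → ℝ}

theorem aestronglyMeasurable_average_sub_integral_prod (hH : AEStronglyMeasurable H (ν.prod μ)) :
    AEStronglyMeasurable (fun w : α × (ι → β) =>
      (Fintype.card ι : ℝ)⁻¹ * ∑ i, H (w.1, w.2 i) - ∫ z, H (w.1, z) ∂μ)
      (ν.prod (Measure.pi fun _ => μ)) := by
  refine .sub (.const_mul (Finset.aestronglyMeasurable_fun_sum _ fun i _ => ?_) _)
    hH.integral_prod_right'.comp_fst
  exact hH.comp_measurePreserving
    ((MeasurePreserving.id ν).prod (measurePreserving_eval (fun _ : ι => μ) i))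

theorem lintegral_enorm_average_sub_integral_prod_le [Nonempty ι]
    (hH : AEStronglyMeasurable H (ν.prod μ)) (hH2 : ∀ᵐ x ∂ν, MemLp (fun z => H (x, z)) 2 μ) :
    ∫⁻ w : α × (ι → β), ‖(Fintype.card ι : ℝ)⁻¹ * ∑ i, H (w.1, w.2 i) - ∫ z, H (w.1, z) ∂μ‖ₑ
        ∂(ν.prod (Measure.pi fun _ => μ)) ≤
      ENNReal.ofReal ((Fintype.card ι : ℝ) ^ (-(1 / 2) : ℝ)) *
        ∫⁻ x, eLpNorm (fun z => H (x, z)) 2 μ ∂ν := by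
  rw [lintegral_prod _ (aestronglyMeasurable_average_sub_integral_prod hH).enorm,
    ← lintegral_const_mul' _ _ ENNReal.ofReal_ne_top]
  exact lintegral_mono_ae (hH2.mono fun x hx => lintegral_enorm_average_sub_integral_le hx)

theorem measurePreserving_castAdd_natAdd (μ : Measure β) [SigmaFinite μ] (m n : ℕ) :
    MeasurePreserving (fun x : Fin (m + n) → β =>
        (fun i => x (Fin.castAdd n i), fun i => x (Fin.natAdd m i)))
      (Measure.pi fun _ => μ) ((Measure.pi fun _ : Fin m => μ).prod (Measure.pi fun _ => μ)) := by
  convert (measurePreserving_sumPiEquivProdPi fun _ : Fin m ⊕ Fin n => μ).comp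
    (measurePreserving_piCongrLeft (fun _ => μ) finSumFinEquiv.symm) using 1
  have hcongr (x : Fin (m + n) → β) (j : Fin m ⊕ Fin n) :
      MeasurableEquiv.piCongrLeft (fun _ => β) finSumFinEquiv.symm x j = x (finSumFinEquiv j) := by
    obtain ⟨i, rfl⟩ := finSumFinEquiv.symm.surjective j
    rw [Equiv.apply_symm_apply]
    exact Equiv.piCongrLeft_apply_apply (fun _ => β) finSumFinEquiv.symm x i
  ext x i
  · exact (hcongr x (.inl i)).symm
  · exact (hcongr x (.inr i)).symm

end MonteCarlo

section Power

theorem abs_pow_sub_pow_le_mul_add (x y : ℝ) {q : ℕ} (hq : 0 < q) :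
    |x ^ q - y ^ q| ≤ q * 2 ^ q * (|y - x| * |x| ^ (q - 1) + |y - x| ^ q) := by
  have hmax : max |x| |y| ≤ |x| + |y - x| := by
    refine max_le (le_add_of_nonneg_right (abs_nonneg _)) ?_
    linarith [abs_sub_abs_le_abs_sub y x]
  have hpow : max |x| |y| ^ (q - 1) ≤ 2 ^ q * (|x| ^ (q - 1) + |y - x| ^ (q - 1)) := by
    calc max |x| |y| ^ (q - 1) ≤ (|x| + |y - x|) ^ (q - 1) := by gcongr
      _ ≤ 2 ^ (q - 1 - 1) * (|x| ^ (q - 1) + |y - x| ^ (q - 1)) :=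
          add_pow_le (abs_nonneg _) (abs_nonneg _) _
      _ ≤ 2 ^ q * (|x| ^ (q - 1) + |y - x| ^ (q - 1)) := by
          gcongr
          · exact one_le_two
          · lia
  calc |x ^ q - y ^ q| ≤ |x - y| * q * max |x| |y| ^ (q - 1) := abs_pow_sub_pow_le x y q
    _ ≤ |x - y| * q * (2 ^ q * (|x| ^ (q - 1) + |y - x| ^ (q - 1))) := by gcongr
    _ = q * 2 ^ q * (|y - x| * |x| ^ (q - 1) + |y - x| * |y - x| ^ (q - 1)) := by
        rw [abs_sub_comm x y]
        ring
    _ = _ := by rw [← pow_succ', Nat.sub_add_cancel hq]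

variable {α : Type*} [MeasurableSpace α] {μ : Measure α} {f g : α → ℝ}

theorem eLpNorm_abs_pow (f : α → ℝ) {k : ℕ} (hk : 0 < k) (t : ℝ≥0∞) :
    eLpNorm (fun x => |f x| ^ k) t μ = eLpNorm f (t * k) μ ^ k := by
  simpa using eLpNorm_norm_rpow (p := t) (μ := μ) f (q := k) (by exact_mod_cast hk)

theorem memLp_pow {k : ℕ} (hk : 0 < k) {t : ℝ≥0∞} (hf : MemLp f (t * k) μ) :
    MemLp (fun x => f x ^ k) t μ := by
  refine ⟨hf.1.pow k, ?_⟩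
  rw [← eLpNorm_norm]
  simp only [norm_pow, Real.norm_eq_abs]
  rw [eLpNorm_abs_pow f hk]
  exact ENNReal.pow_lt_top hf.2

theorem eLpNorm_pow_sub_pow_le (hf : AEStronglyMeasurable f μ) (hg : AEStronglyMeasurable g μ)
    {q : ℕ} (hq : 2 ≤ q) {a b r : ℝ≥0∞} [ENNReal.HolderTriple a b r] (hr : 1 ≤ r) :
    eLpNorm (fun x => f x ^ q - g x ^ q) r μ ≤ ENNReal.ofReal (q * 2 ^ q) *
      (eLpNorm (fun x => g x - f x) a μ * eLpNorm f (b * (q - 1 : ℕ)) μ ^ (q - 1) +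
        eLpNorm (fun x => g x - f x) (r * q) μ ^ q) := by
  have hsub : AEStronglyMeasurable (fun x => g x - f x) μ := hg.sub hf
  have hholder : eLpNorm (fun x => |g x - f x| * |f x| ^ (q - 1)) r μ ≤
      eLpNorm (fun x => g x - f x) a μ * eLpNorm f (b * (q - 1 : ℕ)) μ ^ (q - 1) := by
    have h := eLpNorm_smul_le_mul_eLpNorm (p := a) (q := b) (r := r) (hf.norm.pow (q - 1)) hsub.norm
    have hnorm := eLpNorm_norm (p := a) (μ := μ) fun x => g x - f x
    simp only [Real.norm_eq_abs] at h hnorm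
    rw [← eLpNorm_abs_pow f (by lia), ← hnorm]
    exact h
  calc eLpNorm (fun x => f x ^ q - g x ^ q) r μ
      ≤ eLpNorm (((q : ℝ) * 2 ^ q) • ((fun x => |g x - f x| * |f x| ^ (q - 1)) +
          fun x => |g x - f x| ^ q)) r μ :=
        eLpNorm_mono_real fun x => by
          simpa using abs_pow_sub_pow_le_mul_add (f x) (g x) (q := q) (by lia)
    _ = ENNReal.ofReal (q * 2 ^ q) * eLpNorm ((fun x => |g x - f x| * |f x| ^ (q - 1)) +
          fun x => |g x - f x| ^ q) r μ := by
        rw [eLpNorm_const_smul, Real.enorm_of_nonneg (by positivity)]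
    _ ≤ ENNReal.ofReal (q * 2 ^ q) * (eLpNorm (fun x => |g x - f x| * |f x| ^ (q - 1)) r μ +
          eLpNorm (fun x => |g x - f x| ^ q) r μ) := by
        gcongr
        exact eLpNorm_add_le (hsub.norm.mul (hf.norm.pow _)) (hsub.norm.pow _) hr
    _ ≤ _ := by
        gcongr
        exact (eLpNorm_abs_pow _ (by lia) r).le

end Power

section Average

variable {α β : Type*} [MeasurableSpace α] [MeasurableSpace β] {ν : Measure α}

theorem lintegral_rpow_le_rpow_lintegral_rpow [IsProbabilityMeasure ν] {e : α → ℝ≥0∞}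
    (he : AEMeasurable e ν) {k r : ℝ} (hk : 0 < k) (hkr : k ≤ r) :
    ∫⁻ x, e x ^ k ∂ν ≤ ((∫⁻ x, e x ^ r ∂ν) ^ (1 / r)) ^ k := by
  rw [← ENNReal.rpow_inv_le_iff hk]
  simpa [eLpNorm'] using eLpNorm'_le_eLpNorm'_of_exponent_le hk hkr ν he.aestronglyMeasurable

theorem aemeasurable_eLpNorm_prod {μ : Measure β} [SFinite μ] {H : α × β → ℝ}
    (hH : AEMeasurable H (ν.prod μ)) {r : ℝ} (hr : 0 < r) :
    AEMeasurable (fun x => eLpNorm (fun z => H (x, z)) (ENNReal.ofReal r) μ) ν := by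
  simp only [eLpNorm_eq_lintegral_rpow_enorm_toReal (p := ENNReal.ofReal r) (by simpa using hr)
    (by simp), ENNReal.toReal_ofReal hr.le]
  exact ((hH.enorm.pow_const r).lintegral_prod_right').pow_const _

end Average

section Exponents

/-- With `σ = s / d`, the term `(g - f) f ^ (q - 1)` is estimated in `L^2` by Hölder's inequality
with exponents `a` and `b`. The smallest `1 / a` for which the oracle rate in `L^a` is the claimed
one is `min (1 / p) (1 / 2 - (q - 1) (1 / p - σ))`, and this choice keeps both `L^a` and
`L^{b (q - 1)}` in the range of the Sobolev embedding. -/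
theorem exists_holderTriple_rate {q : ℕ} {p σ : ℝ} (hp : 2 < p) (hq : 2 ≤ q) (hσ : 0 < σ)
    (hT : 1 / p - σ < 1 / (2 * q)) :
    ∃ a b : ℝ, 1 ≤ a ∧ a.HolderTriple b 2 ∧ 1 / p - σ < 1 / a ∧ 1 < b * (q - 1 : ℕ) ∧
      1 / p - σ ≤ 1 / (b * (q - 1 : ℕ)) ∧
      -σ + max (1 / p - 1 / a) 0 = max (-(q : ℝ) * (σ - 1 / p) - 1 / 2) (-σ) := by
  have hq2 : (2 : ℝ) ≤ q := by exact_mod_cast hq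
  have hp2 : 1 / p < 1 / 2 := one_div_lt_one_div_of_lt two_pos hp
  have hp0 : 0 < 1 / p := by positivity
  set T := 1 / p - σ with hTdef
  have hqT : q * T < 1 / 2 := by
    rw [lt_div_iff₀ (by positivity)] at hT
    linarith
  set t := min (1 / p) (1 / 2 - (q - 1) * T) with ht
  have htT : t ≤ 1 / 2 - (q - 1) * T := min_le_right _ _
  have htp : t ≤ 1 / p := min_le_left _ _
  have ht0 : 0 < t := by
    refine lt_min hp0 ?_
    rcases le_total T 0 with h | h <;> nlinarith
  have ht2 : 0 < 1 / 2 - t := by linarith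
  refine ⟨1 / t, 1 / (1 / 2 - t), ?_, ⟨by simp, by positivity, by positivity⟩, ?_, ?_, ?_, ?_⟩
  · rw [le_div_iff₀ ht0]
    linarith
  · rw [one_div_one_div]
    exact lt_min (by linarith) (by linarith)
  · rw [div_mul_eq_mul_div, lt_div_iff₀ ht2, Nat.cast_pred (by lia)]
    linarith
  · rw [div_mul_eq_mul_div, one_mul, one_div_div, Nat.cast_pred (by lia), le_div_iff₀ (by linarith)]
    linarith
  · rw [one_div_one_div, max_eq_left (by linarith), ht, ← sub_eq_zero, hTdef]
    rcases le_total (1 / p) (1 / 2 - (q - 1) * T) with h | h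
    · rw [min_eq_left h, max_eq_right (by linarith)]
      ring
    · rw [min_eq_right h, max_eq_left (by linarith)]
      ring

theorem one_div_sub_lt_one_div_two_mul {d s q : ℕ} {p : ℝ} (hd : 0 < d) (hp : 0 < p) (hq : 0 < q)
    (hs : (d : ℝ) * (2 * q - p) / (2 * p * q) < s) : 1 / p - (s : ℝ) / d < 1 / (2 * q) := by
  have hdiv : (2 * q - p) / (2 * p * q) < (s : ℝ) / d := by
    rw [lt_div_iff₀ (by positivity)]
    linarith [mul_div_assoc (d : ℝ) (2 * q - p) (2 * p * q)]
  have hsplit : (2 * q - p) / (2 * p * q) = 1 / p - 1 / (2 * q) := by field_simp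
  linarith

end Exponents

section Residual

variable {d s q m : ℕ} {p : ℝ} {K : Oracle d} {f : (Fin d → ℝ) → ℝ}

instance (d n : ℕ) : IsProbabilityMeasure (sampleLaw d n) := by
  rw [sampleLaw]
  infer_instance

theorem ae_sampleLaw_mem_cube (d n : ℕ) : ∀ᵐ x ∂sampleLaw d n, ∀ i, x i ∈ cube d :=
  ae_all_iff.2 fun i =>
    (measurePreserving_eval (fun _ : Fin n => unif d) i).quasiMeasurePreserving.ae
      (ae_restrict_mem (measurableSet_cube d))

/-- The risk `(E ‖K_m(x, f(x)) - f‖_{L^r}^r)^{1/r}` of the oracle, as in `HasOracleRate`. -/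
noncomputable def oracleRisk (K : Oracle d) (m : ℕ) (f : (Fin d → ℝ) → ℝ) (r : ℝ) : ℝ≥0∞ :=
  (∫⁻ x, eLpNorm (fun z => K m x (f ∘ x) z - f z) (ENNReal.ofReal r) (unif d) ^ r
    ∂(sampleLaw d m)) ^ (1 / r)

/-- The function `f ^ q - g ^ q` that is left to Monte Carlo integration by the control variate `g`
fitted to the sample `w.1`, evaluated at the point `w.2`. -/
noncomputable def residual (K : Oracle d) (q m : ℕ) (f : (Fin d → ℝ) → ℝ)
    (w : (Fin m → Fin d → ℝ) × (Fin d → ℝ)) : ℝ :=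
  f w.2 ^ q - K m w.1 (f ∘ w.1) w.2 ^ q

theorem aemeasurable_residual (hK : IsFunctionEstimator d s p K) (hm : 0 < m)
    (hf : f ∈ sobolev d s p) :
    AEMeasurable (residual K q m f) ((sampleLaw d m).prod (unif d)) :=
  (hf.1.1.aemeasurable.comp_snd.pow_const q).sub ((hK.aemeasurable m hm f hf).pow_const q)

theorem memLp_pow_of_mem_sobolev (hd : 0 < d) (hp : 1 < p) (hq : 0 < q)
    (hs : 1 / p - (s : ℝ) / d ≤ 1 / (2 * q)) (hf : f ∈ sobolev d s p) :
    MemLp (fun z => f z ^ q) 2 (unif d) := by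
  have hq1 : (1 : ℝ) ≤ q := by exact_mod_cast hq
  refine memLp_pow hq ?_
  simpa [ENNReal.ofReal_mul] using
    memLp_of_mem_sobolev (r := 2 * q) hd hp (by linarith) (by simpa using hs) hf

theorem lintegral_eLpNorm_residual_le (hK : IsFunctionEstimator d s p K) (hm : 0 < m)
    (hq : 2 ≤ q) (hf : f ∈ sobolev d s p) {a b : ℝ} (ha : 1 ≤ a) (hab : a.HolderTriple b 2) :
    ∫⁻ x, eLpNorm (fun z => residual K q m f (x, z)) 2 (unif d) ∂(sampleLaw d m) ≤
      ENNReal.ofReal (q * 2 ^ q) *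
        (oracleRisk K m f a * eLpNorm f (ENNReal.ofReal (b * (q - 1 : ℕ))) (unif d) ^ (q - 1) +
          oracleRisk K m f (2 * q) ^ q) := by
  set e : ℝ → (Fin m → Fin d → ℝ) → ℝ≥0∞ := fun r x =>
    eLpNorm (fun z => K m x (f ∘ x) z - f z) (ENNReal.ofReal r) (unif d)
  set M := eLpNorm f (ENNReal.ofReal (b * (q - 1 : ℕ))) (unif d)
  have hq0 : (0 : ℝ) < q := by exact_mod_cast (by lia : 0 < q)
  have he {r : ℝ} (hr : 0 < r) : AEMeasurable (e r) (sampleLaw d m) :=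
    aemeasurable_eLpNorm_prod ((hK.aemeasurable m hm f hf).sub hf.1.1.aemeasurable.comp_snd) hr
  have hrisk_a : ∫⁻ x, e a x ∂sampleLaw d m ≤ oracleRisk K m f a := by
    simpa only [ENNReal.rpow_one] using!
      lintegral_rpow_le_rpow_lintegral_rpow (he (by linarith)) one_pos ha
  have hrisk_q : ∫⁻ x, e (2 * q) x ^ q ∂sampleLaw d m ≤ oracleRisk K m f (2 * q) ^ q := by
    simpa only [ENNReal.rpow_natCast] using!
      lintegral_rpow_le_rpow_lintegral_rpow (he (by positivity)) hq0 (by linarith : (q : ℝ) ≤ 2 * q)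
  have hpoint : ∀ᵐ x ∂sampleLaw d m, eLpNorm (fun z => residual K q m f (x, z)) 2 (unif d) ≤
      ENNReal.ofReal (q * 2 ^ q) * (e a x * M ^ (q - 1) + e (2 * q) x ^ q) := by
    filter_upwards [ae_sampleLaw_mem_cube d m] with x hx
    have := hab.ennrealOfReal
    rw [ENNReal.ofReal_ofNat] at this
    simpa [ENNReal.ofReal_mul, ENNReal.ofReal_mul hab.right_pos.le, e, M] using!
      eLpNorm_pow_sub_pow_le (a := .ofReal a) (b := .ofReal b) (r := 2) hf.1.1
        (hK.mem_sobolev m hm x hx (f ∘ x)).1.1 hq one_le_two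
  calc ∫⁻ x, eLpNorm (fun z => residual K q m f (x, z)) 2 (unif d) ∂(sampleLaw d m)
      ≤ ∫⁻ x, ENNReal.ofReal (q * 2 ^ q) * (e a x * M ^ (q - 1) + e (2 * q) x ^ q)
          ∂(sampleLaw d m) := lintegral_mono_ae hpoint
    _ = ENNReal.ofReal (q * 2 ^ q) * ((∫⁻ x, e a x ∂sampleLaw d m) * M ^ (q - 1) +
          ∫⁻ x, e (2 * q) x ^ q ∂sampleLaw d m) := by
        rw [lintegral_const_mul' _ _ ENNReal.ofReal_ne_top,
          lintegral_add_left' ((he (by linarith)).mul_const _),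
          lintegral_mul_const'' _ (he (by linarith))]
    _ ≤ _ := by gcongr

variable {F : Set ((Fin d → ℝ) → ℝ)}

theorem HasOracleRate.exists_oracleRisk_le (hrate : HasOracleRate d s p K F) (hd : 0 < d)
    (hp : 0 < p) {r : ℝ} (hr : 1 ≤ r) (hs : 1 / p - (s : ℝ) / d < 1 / r) :
    ∃ C : ℝ≥0, ∀ f ∈ F, ∀ m : ℕ, 0 < m → oracleRisk K m f r ≤
      C * ENNReal.ofReal ((m : ℝ) ^ (-((s : ℝ) / d) + max (1 / p - 1 / r) 0)) := by
  have hrange : (d - s * p) / (p * d) = 1 / p - (s : ℝ) / d := by field_simp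
  obtain ⟨C, hC⟩ := hrate r hr (by rwa [hrange])
  refine ⟨C.toNNReal, fun f hf m hm => (hC f hf m hm).trans_eq ?_⟩
  rw [ENNReal.ofReal_mul' (by positivity), neg_div]
  rfl

theorem HasOracleRate.exists_oracleRisk_two_mul_pow_le (hrate : HasOracleRate d s p K F)
    (hd : 0 < d) (hp : 0 < p) (hq : 0 < q) (hpq : p ≤ 2 * q)
    (hs : 1 / p - (s : ℝ) / d < 1 / (2 * q)) :
    ∃ C : ℝ≥0, ∀ f ∈ F, ∀ m : ℕ, 0 < m → oracleRisk K m f (2 * q) ^ q ≤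
      C * ENNReal.ofReal ((m : ℝ) ^ (-(q : ℝ) * ((s : ℝ) / d - 1 / p) - 1 / 2)) := by
  have hq1 : (1 : ℝ) ≤ q := by exact_mod_cast hq
  have hpq' : 1 / (2 * (q : ℝ)) ≤ 1 / p := one_div_le_one_div_of_le hp hpq
  obtain ⟨C, hC⟩ := hrate.exists_oracleRisk_le hd hp (by linarith) hs
  refine ⟨C ^ q, fun f hf m hm => (pow_le_pow_left₀ zero_le (hC f hf m hm) q).trans_eq ?_⟩
  rw [max_eq_left (by linarith), mul_pow, ENNReal.coe_pow, ← ENNReal.ofReal_pow (by positivity),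
    ← Real.rpow_mul_natCast m.cast_nonneg]
  congr 3
  field_simp
  ring

theorem exists_lintegral_eLpNorm_residual_le (hd : 0 < d) (hp : 2 < p) (hpq : p < 2 * q)
    (hs : 1 / p - (s : ℝ) / d < 1 / (2 * q)) (hK : IsFunctionEstimator d s p K) {R : ℝ}
    (hF : F ⊆ sobolevBall d s p R) (hrate : HasOracleRate d s p K F) :
    ∃ D : ℝ≥0, ∀ f ∈ F, ∀ m : ℕ, 0 < m →
      ∫⁻ x, eLpNorm (fun z => residual K q m f (x, z)) 2 (unif d) ∂(sampleLaw d m) ≤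
        D * ENNReal.ofReal
          ((m : ℝ) ^ max (-(q : ℝ) * ((s : ℝ) / d - 1 / p) - 1 / 2) (-((s : ℝ) / d))) := by
  have hq1 : (1 : ℝ) < q := by linarith
  have hq : 2 ≤ q := by exact_mod_cast hq1
  have hpq' : 1 / (2 * (q : ℝ)) < 1 / p := one_div_lt_one_div_of_lt (by linarith) hpq
  obtain ⟨a, b, ha, hab, hsa, hb, hsb, hexp⟩ :=
    exists_holderTriple_rate hp hq (by linarith : 0 < (s : ℝ) / d) hs
  obtain ⟨Ca, hCa⟩ := hrate.exists_oracleRisk_le hd (by linarith) ha hsa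
  obtain ⟨Cq, hCq⟩ := hrate.exists_oracleRisk_two_mul_pow_le hd (by linarith) (by lia) hpq.le hs
  obtain ⟨M, hM⟩ := exists_eLpNorm_le_of_mem_sobolevBall hd s (p := p) (by linarith) hb
    (by simpa using hsb) R
  refine ⟨(q * 2 ^ q : ℝ).toNNReal * (Ca * M.toNNReal ^ (q - 1) + Cq), fun f hf m hm => ?_⟩
  rw [hexp] at hCa
  set E := max (-(q : ℝ) * ((s : ℝ) / d - 1 / p) - 1 / 2) (-((s : ℝ) / d))
  have hm1 : (1 : ℝ) ≤ m := by exact_mod_cast hm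
  have hrisk : oracleRisk K m f (2 * q) ^ q ≤ Cq * ENNReal.ofReal ((m : ℝ) ^ E) := by
    refine (hCq f hf m hm).trans ?_
    gcongr
    exact le_max_left _ _
  calc _ ≤ _ := lintegral_eLpNorm_residual_le hK hm hq
        (sobolevBall_subset_sobolev d s p R (hF hf)) ha hab
    _ ≤ ENNReal.ofReal (q * 2 ^ q) * (Ca * ENNReal.ofReal ((m : ℝ) ^ E) *
        ENNReal.ofReal M ^ (q - 1) + Cq * ENNReal.ofReal ((m : ℝ) ^ E)) := by
        gcongr
        · exact hCa f hf m hm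
        · exact hM f (hF hf)
    _ = _ := by
        push_cast
        simp only [ENNReal.ofReal]
        ring

end Residual

section Error

variable {d s q m : ℕ} {p : ℝ} {K : Oracle d} {f : (Fin d → ℝ) → ℝ}

theorem estimator_sub_moment_eq {x : Fin (m + m) → Fin d → ℝ}
    (hf : Integrable (fun z => f z ^ q) (unif d))
    (hg : Integrable (fun z => K m (fun i => x (Fin.castAdd m i))
      (f ∘ fun i => x (Fin.castAdd m i)) z ^ q) (unif d)) :
    estimator K q m x (f ∘ x) - moment q f =
      (m : ℝ)⁻¹ * ∑ i, residual K q m f (fun i => x (Fin.castAdd m i), x (Fin.natAdd m i)) -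
        ∫ z, residual K q m f (fun i => x (Fin.castAdd m i), z) ∂unif d := by
  have hcoeff : 2 / ((m + m : ℕ) : ℝ) = (m : ℝ)⁻¹ := by
    rw [← two_mul, Nat.cast_mul, Nat.cast_ofNat, div_mul_cancel_left₀ two_ne_zero]
  simp only [estimator, moment, residual, hcoeff]
  rw [integral_sub hf hg]
  simp only [unif, Function.comp_def]
  ring

theorem estimator_sub_moment_ae_eq (hK : IsFunctionEstimator d s p K) (hd : 0 < d) (hp : 1 < p)
    (hm : 0 < m) (hq : 0 < q) (hs : 1 / p - (s : ℝ) / d ≤ 1 / (2 * q)) (hf : f ∈ sobolev d s p) :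
    (fun x => estimator K q m x (f ∘ x) - moment q f) =ᵐ[sampleLaw d (m + m)]
      (fun w : (Fin m → Fin d → ℝ) × (Fin m → Fin d → ℝ) =>
        (Fintype.card (Fin m) : ℝ)⁻¹ * ∑ i, residual K q m f (w.1, w.2 i) -
          ∫ z, residual K q m f (w.1, z) ∂unif d) ∘
        fun x => (fun i => x (Fin.castAdd m i), fun i => x (Fin.natAdd m i)) := by
  filter_upwards [ae_sampleLaw_mem_cube d (m + m)] with x hx
  have hg := hK.mem_sobolev m hm (fun i => x (Fin.castAdd m i)) (fun i => hx _)
    (f ∘ fun i => x (Fin.castAdd m i))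
  simpa using estimator_sub_moment_eq
    ((memLp_pow_of_mem_sobolev hd hp hq hs hf).integrable one_le_two)
    ((memLp_pow_of_mem_sobolev hd hp hq hs hg).integrable one_le_two)

theorem aestronglyMeasurable_estimator_sub_moment (hK : IsFunctionEstimator d s p K) (hd : 0 < d)
    (hp : 1 < p) (hm : 0 < m) (hq : 0 < q) (hs : 1 / p - (s : ℝ) / d ≤ 1 / (2 * q))
    (hf : f ∈ sobolev d s p) :
    AEStronglyMeasurable (fun x => estimator K q m x (f ∘ x) - moment q f)
      (sampleLaw d (m + m)) :=
  ((aestronglyMeasurable_average_sub_integral_prod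
    (aemeasurable_residual hK hm hf).aestronglyMeasurable).comp_measurePreserving
      (measurePreserving_castAdd_natAdd (unif d) m m)).congr
        (estimator_sub_moment_ae_eq hK hd hp hm hq hs hf).symm

theorem lintegral_enorm_estimator_sub_moment_le (hK : IsFunctionEstimator d s p K) (hd : 0 < d)
    (hp : 1 < p) (hm : 0 < m) (hq : 0 < q) (hs : 1 / p - (s : ℝ) / d ≤ 1 / (2 * q))
    (hf : f ∈ sobolev d s p) :
    ∫⁻ x, ‖estimator K q m x (f ∘ x) - moment q f‖ₑ ∂(sampleLaw d (m + m)) ≤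
      ENNReal.ofReal ((m : ℝ) ^ (-(1 / 2) : ℝ)) *
        ∫⁻ x, eLpNorm (fun z => residual K q m f (x, z)) 2 (unif d) ∂(sampleLaw d m) := by
  have : Nonempty (Fin m) := ⟨⟨0, hm⟩⟩
  have hsplit := measurePreserving_castAdd_natAdd (unif d) m m
  have hmeas : AEStronglyMeasurable (residual K q m f) ((sampleLaw d m).prod (unif d)) :=
    (aemeasurable_residual hK hm hf).aestronglyMeasurable
  have hL2 : ∀ᵐ x ∂sampleLaw d m, MemLp (fun z => residual K q m f (x, z)) 2 (unif d) := by
    filter_upwards [ae_sampleLaw_mem_cube d m] with x hx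
    exact (memLp_pow_of_mem_sobolev hd hp hq hs hf).sub
      (memLp_pow_of_mem_sobolev hd hp hq hs (hK.mem_sobolev m hm x hx (f ∘ x)))
  refine (lintegral_congr_ae
    ((estimator_sub_moment_ae_eq hK hd hp hm hq hs hf).fun_comp (‖·‖ₑ))).trans_le ?_
  have hbound := lintegral_enorm_average_sub_integral_prod_le (ι := Fin m) hmeas hL2
  rw [sampleLaw, ← hsplit.map_eq, lintegral_map' _ hsplit.measurable.aemeasurable] at hbound
  · simpa using! hbound
  · rw [hsplit.map_eq]
    exact (aestronglyMeasurable_average_sub_integral_prod hmeas).enorm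

theorem errorBound_of_lintegral_le {D : ℝ≥0}
    (hmeas : ∀ m : ℕ, 0 < m → AEStronglyMeasurable
      (fun x => estimator K q m x (f ∘ x) - moment q f) (sampleLaw d (m + m)))
    (hD : ∀ m : ℕ, 0 < m →
      ∫⁻ x, ‖estimator K q m x (f ∘ x) - moment q f‖ₑ ∂(sampleLaw d (m + m)) ≤
        D * ENNReal.ofReal ((m : ℝ) ^
          max (-(q : ℝ) * ((s : ℝ) / d - 1 / p) - 1) (-(s : ℝ) / d - 1 / 2))) :
    ErrorBound d s q p K f
      (D * 2 ^ (-max (-(q : ℝ) * ((s : ℝ) / d - 1 / p) - 1) (-(s : ℝ) / d - 1 / 2))) := by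
  intro m hm
  set E := max (-(q : ℝ) * ((s : ℝ) / d - 1 / p) - 1) (-(s : ℝ) / d - 1 / 2)
  have hhalf : (2 : ℝ) ^ (-E) * ((m + m : ℕ) : ℝ) ^ E = (m : ℝ) ^ E := by
    rw [← two_mul, Nat.cast_mul, Nat.cast_ofNat, Real.mul_rpow zero_le_two m.cast_nonneg,
      ← mul_assoc, ← Real.rpow_add two_pos, neg_add_cancel, Real.rpow_zero, one_mul]
  refine ⟨⟨hmeas m hm, (hD m hm).trans_lt (ENNReal.mul_lt_top (by simp) (by simp))⟩, ?_⟩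
  calc ∫ x, |estimator K q m x (f ∘ x) - moment q f| ∂(sampleLaw d (m + m))
      = (∫⁻ x, ‖estimator K q m x (f ∘ x) - moment q f‖ₑ ∂(sampleLaw d (m + m))).toReal :=
        integral_norm_eq_lintegral_enorm (hmeas m hm)
    _ ≤ D * (m : ℝ) ^ E := by
        refine ENNReal.toReal_le_of_le_ofReal (by positivity) ((hD m hm).trans_eq ?_)
        rw [ENNReal.ofReal_mul D.coe_nonneg, ENNReal.ofReal_coe_nnreal]
    _ = D * 2 ^ (-E) * ((m + m : ℕ) : ℝ) ^ E := by rw [mul_assoc, hhalf]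

end Error

end ControlVariate

open ControlVariate in
theorem theorem3p1_general {d s q : ℕ} {p R : ℝ} (hd : 0 < d) (hp : 2 < p) (hpq : p < 2 * q)
    (hs : (d : ℝ) * (2 * q - p) / (2 * p * q) < s) {K : Oracle d}
    (hK : IsFunctionEstimator d s p K) {F : Set ((Fin d → ℝ) → ℝ)}
    (hF : F ⊆ sobolevBall d s p R) (hrate : HasOracleRate d s p K F) :
    ∃ C : ℝ, ∀ f ∈ F, ErrorBound d s q p K f C := by
  have hq : 0 < q := by
    have : (0 : ℝ) < q := by linarith
    exact_mod_cast this
  have hs' := one_div_sub_lt_one_div_two_mul hd (by linarith) hq hs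
  obtain ⟨D, hD⟩ := exists_lintegral_eLpNorm_residual_le hd hp hpq hs' hK hF hrate
  refine ⟨_, fun f hf => errorBound_of_lintegral_le (D := D) (fun m hm => ?_)
    fun m hm => ?_⟩
  · exact aestronglyMeasurable_estimator_sub_moment hK hd (by linarith) hm hq hs'.le
      (sobolevBall_subset_sobolev d s p R (hF hf))
  · have hm0 : (0 : ℝ) < m := by exact_mod_cast hm
    calc _ ≤ _ := lintegral_enorm_estimator_sub_moment_le hK hd (by linarith) hm hq
          hs'.le (sobolevBall_subset_sobolev d s p R (hF hf))
      _ ≤ ENNReal.ofReal ((m : ℝ) ^ (-(1 / 2) : ℝ)) * (D * ENNReal.ofReal ((m : ℝ) ^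
          max (-(q : ℝ) * ((s : ℝ) / d - 1 / p) - 1 / 2) (-((s : ℝ) / d)))) := by
        gcongr
        exact hD f hf m hm
      _ = _ := by
        rw [mul_left_comm, ← ENNReal.ofReal_mul (by positivity), ← Real.rpow_add hm0, add_comm,
          ← sub_eq_add_neg, ← max_sub_sub_right, neg_div, sub_sub]
        norm_num

/-- Part one: constants independent of `n` in the hypothesis and in the conclusion. Part two: if the
constants of the oracle are uniform over a ball of the Sobolev space, so is the final constant. -/
theorem theorem3p1 (d s q : ℕ) (p : ℝ) (hd : 0 < d) (hp : 2 < p) (hqp : (q : ℝ) < p)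
    (hpq : p < 2 * q) (hs : (d : ℝ) * (2 * q - p) / (2 * p * q) < s)
    (K : ControlVariate.Oracle d) (hK : ControlVariate.IsFunctionEstimator d s p K) :
    (∀ f ∈ ControlVariate.sobolev d s p, ControlVariate.HasOracleRate d s p K {f} →
      ∃ C : ℝ, ControlVariate.ErrorBound d s q p K f C) ∧
    (∀ R : ℝ, ControlVariate.HasOracleRate d s p K (ControlVariate.sobolevBall d s p R) →
      ∃ C : ℝ, ∀ f ∈ ControlVariate.sobolevBall d s p R,
        ControlVariate.ErrorBound d s q p K f C) :=
  ⟨fun _ hf hrate =>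
    let ⟨_, hR⟩ := ControlVariate.exists_mem_sobolevBall hf
    (theorem3p1_general hd hp hpq hs hK (Set.singleton_subset_iff.2 hR) hrate).imp
      fun _ hC => hC _ rfl,
  fun _ hrate => theorem3p1_general hd hp hpq hs hK subset_rfl hrate⟩
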